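/- **Corollary (CDF of the $n$-th dominant interference power).** Let $\Phi=\{x_i\}$ be a homogeneous Poisson point process on $\mathbb{R}^2$ with intensity $\lambda>0$, let $\alpha>2$ and $0<\phi\le 2\pi$, and let the channel gains $h_i$ be i.i.d., almost surely positive random variables, independent of $(x_i)$, with $\bar h_{2/\alpha}:=E[h^{2/\alpha}]<\infty$. A receiver at $x\in\mathbb{R}^2$ receives the power $h_i\|x-x_i\|^{-\alpha}$ from node $i$; its interferers are the nodes $x_i$ for which the angle in $[0,2\pi)$ of the vector $x_i-x$ with the horizontal axis is at most $\phi$. For $z\ge 0$ let $N_z$ be the number of points in $[0,z]$ of the transformed process $\Phi_2=\{\|x_i-x\|^{\alpha}/h_i : x_i \text{ an interferer}\}$, and let $\Lambda_2(z)=E[N_z]$. Then: 1. almost surely, the powers received from the interferers can be arranged into a strictly decreasing sequence $I_1>I_2>\cdots$ in which every interferer occurs exactly once ($I_n$ is the $n$-th dominant interference power); 2. for all $z\ge 0$, $\Lambda_2(z)=\frac{\phi\lambda}{2}\,\bar h_{2/\alpha}\,z^{2/\alpha}$, and $N_z$ is a Poisson random variable with mean $\Lambda_2(z)$; 3. for every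 $n\ge 1$, $I_n$ is a random variable with the CDF $$F_{I_n}(z)=P(I_n\le z)=\frac{\Gamma\left(n,\Lambda_2(z^{-1})\right)}{\Gamma(n)}\quad (z>0),\qquad F_{I_n}(z)=0\quad (z\le 0),$$ where $\Gamma(a,b)=\int_b^\infty t^{a-1}e^{-t}\,dt$ is the upper incomplete gamma function. -/

import Mathlib

open MeasureTheory ProbabilityTheory

noncomputable section

namespace Interference

/-- The Euclidean plane. -/
abbrev Plane : Type := EuclideanSpace ℝ (Fin 2)

/-- Number of indices `i` with `x i ∈ B`: the number of points, counted with multiplicity, that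
the point pattern `{x i}` has in `B`. -/
def pointCount {E : Type*} (x : ℕ → E) (B : Set E) : ℕ∞ :=
  {i : ℕ | x i ∈ B}.encard

/-- The random points `x 0, x 1, …` enumerate a homogeneous Poisson point process on the plane
with intensity `lam` per unit area: the number of points in a Borel set `B` of finite area is
Poisson with mean `lam * area B`, and the numbers of points in pairwise disjoint such sets are
independent. (For `lam > 0` the process has infinitely many points almost surely, so that an
enumeration by `ℕ` is no restriction.) -/
structure IsHomogeneousPPP {Ω : Type*} [MeasurableSpace Ω] (P : Measure Ω) (lam : ℝ)
    (x : ℕ → Ω → Plane) : Prop where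
  measurable : ∀ i, Measurable (x i)
  count_law : ∀ B : Set Plane, MeasurableSet B → volume B ≠ ⊤ → ∀ k : ℕ,
    P {ω | pointCount (fun i => x i ω) B = k} =
      poissonMeasure (Real.toNNReal (lam * (volume B).toReal)) {k}
  count_indep : ∀ (m : ℕ) (B : Fin m → Set Plane), (∀ j, MeasurableSet (B j)) →
    (∀ j, volume (B j) ≠ ⊤) → Pairwise (fun j l => Disjoint (B j) (B l)) →
    iIndepFun (fun j ω => pointCount (fun i => x i ω) (B j)) P

/-- The angle in `[0, 2π)` of a plane vector, measured from the horizontal axis. -/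
def planeAngle (v : Plane) : ℝ :=
  toIcoMod Real.two_pi_pos 0 (Complex.arg ⟨v 0, v 1⟩)

/-- Indices of the interferers of a receiver at `r` with reception angle `φ`: the nodes seen from
`r` at an angle at most `φ`. -/
def interferers (r : Plane) (φ : ℝ) (x : ℕ → Plane) : Set ℕ :=
  {i | planeAngle (x i - r) ≤ φ}

/-- Interference power `h ‖r - y‖ ^ (-α)` received at `r` from a node at `y` with channel
gain `h`. -/
def power (α : ℝ) (r y : Plane) (h : ℝ) : ℝ :=
  h * ‖r - y‖ ^ (-α)

/-- The `n`-th dominant interference power (`n ≥ 1`): the `n`-th largest, counted with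
multiplicity, of the powers received from the interferers, that is, the largest `t` such that at
least `n` interferers have power at least `t`. -/
def nthDominant (α φ : ℝ) (r : Plane) (x : ℕ → Plane) (h : ℕ → ℝ) (n : ℕ) : ℝ :=
  sSup {t : ℝ | (n : ℕ∞) ≤ {i | i ∈ interferers r φ x ∧ t ≤ power α r (x i) (h i)}.encard}

/-- `I 1 > I 2 > …` is the arrangement in descending order of the family of powers received from
the interferers, every interferer occurring exactly once. -/
def IsDescendingArrangement (α φ : ℝ) (r : Plane) (x : ℕ → Plane) (h : ℕ → ℝ) (I : ℕ → ℝ) :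
    Prop :=
  StrictAnti (fun n : ℕ => I (n + 1)) ∧
    ∃ s : ℕ → ℕ, Set.BijOn s Set.univ (interferers r φ x) ∧
      ∀ n : ℕ, I (n + 1) = power α r (x (s n)) (h (s n))

/-- The number `N_z` of points in `[0, z]` of the transformed process
`{‖x i - r‖ ^ α / h i : i an interferer}` on the power axis. -/
def transformedCount (α φ : ℝ) (r : Plane) (x : ℕ → Plane) (h : ℕ → ℝ) (z : ℝ) : ℕ∞ :=
  {i | i ∈ interferers r φ x ∧ ‖x i - r‖ ^ α / h i ∈ Set.Icc 0 z}.encard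

/-- The intensity measure `Λ₂(z) = E[N_z]` of `[0, z]` under the transformed process. -/
def transformedIntensity {Ω : Type*} [MeasurableSpace Ω] (P : Measure Ω) (α φ : ℝ) (r : Plane)
    (x : ℕ → Ω → Plane) (h : ℕ → Ω → ℝ) (z : ℝ) : ENNReal :=
  ∫⁻ ω, (transformedCount α φ r (fun i => x i ω) (fun i => h i ω) z : ENNReal) ∂P

/-- The upper incomplete gamma function `Γ(a, b) = ∫_b^∞ t ^ (a - 1) e ^ (-t) dt`. -/
def upperGamma (a b : ℝ) : ℝ :=
  ∫ t in Set.Ioi b, t ^ (a - 1) * Real.exp (-t)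

end Interference

end

/-!
The nodes marked with their channel gains form a Poisson process on `Plane × ℝ`: averaging the
probability generating functional over the marks replaces a test function `w` by
`y ↦ ∫ w (y, t) dν`. Mapping a marked node to `‖x i - r‖ ^ α / h i` then gives Poisson counts whose
mean on `[0, z]` is an average of areas of sectors, `φ / 2 * (z * t) ^ (2 / α)` for a gain `t`. This
intensity is diffuse, so the points are almost surely distinct (cut a set into many small pieces:
the probability that some piece holds two points is at most the sum of the squared masses), and it
is locally finite with infinite total mass, so they can be listed in increasing order. Their
inverses are the powers, hence `I n ≤ z` almost surely means that fewer than `n` transformed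
points lie in `[0, 1 / z]`, and a Poisson distribution function is a normalized incomplete gamma
function.
-/

namespace Interference

open Filter
open scoped ENNReal NNReal Topology

section PoissonLaw

/-- The power `u ^ k` with an exponent that may be infinite; `u ^ ⊤ = 0`, the limit of `u ^ k`
for `u < 1`. The generating function of an `ℕ∞`-valued variable `N` is `u ↦ E[enatPow u N]`. -/
noncomputable def enatPow (u : ℝ≥0∞) (k : ℕ∞) : ℝ≥0∞ :=
  ENat.recTopCoe 0 (fun m => u ^ m) k

@[simp]
theorem enatPow_natCast (u : ℝ≥0∞) (k : ℕ) : enatPow u k = u ^ k := rfl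

@[simp]
theorem enatPow_top (u : ℝ≥0∞) : enatPow u ⊤ = 0 := rfl

theorem enatPow_antitone {u : ℝ≥0∞} (hu : u ≤ 1) : Antitone (enatPow u) := by
  intro k l hkl
  induction l using ENat.recTopCoe with
  | top => simp
  | coe l =>
    lift k to ℕ using ne_top_of_le_ne_top (ENat.natCast_ne_top l) hkl
    exact pow_le_pow_right_of_le_one' hu (by exact_mod_cast hkl)

theorem enatPow_eq_zero_iff {u : ℝ≥0∞} (hu : u ≠ 0) {k : ℕ∞} : enatPow u k = 0 ↔ k = ⊤ := by
  induction k using ENat.recTopCoe <;> simp [hu]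

theorem lintegral_enatPow (ρ : Measure ℕ∞) (u : ℝ≥0∞) :
    ∫⁻ k, enatPow u k ∂ρ = ∑' k : ℕ, u ^ k * ρ {(k : ℕ∞)} := by
  rw [lintegral_countable', ← Nat.cast_injective (R := ℕ∞) |>.tsum_eq]
  · simp
  · intro k hk
    induction k using ENat.recTopCoe <;> simp_all

theorem hasFPowerSeriesAt_tsum_pow_mul {c : ℕ → ℝ} (hc : ∀ n, ‖c n‖ ≤ 1) :
    HasFPowerSeriesAt (fun s => ∑' n, s ^ n * c n)
      (FormalMultilinearSeries.ofScalars ℝ c) 0 := by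
  have hradius : 1 ≤ (FormalMultilinearSeries.ofScalars ℝ c).radius :=
    FormalMultilinearSeries.le_radius_of_bound _ 1 (r := 1) fun n => by
      simpa [FormalMultilinearSeries.ofScalars_norm] using hc n
  convert! (FormalMultilinearSeries.hasFPowerSeriesOnBall _
    (one_pos.trans_le hradius)).hasFPowerSeriesAt using 1
  ext s
  rw [← FormalMultilinearSeries.ofScalarsSum.eq_1, FormalMultilinearSeries.ofScalars_sum_eq]
  simp [mul_comm]

theorem eq_of_tsum_pow_mul_eq {a b : ℕ → ℝ} (ha : ∀ n, ‖a n‖ ≤ 1) (hb : ∀ n, ‖b n‖ ≤ 1)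
    (hab : ∀ s ∈ Set.Ioo (0 : ℝ) 1, ∑' n, s ^ n * a n = ∑' n, s ^ n * b n) : a = b := by
  have hsa := hasFPowerSeriesAt_tsum_pow_mul ha
  have hsb := hasFPowerSeriesAt_tsum_pow_mul hb
  have hright : ∀ᶠ s in 𝓝[>] (0 : ℝ), ∑' n, s ^ n * a n = ∑' n, s ^ n * b n := by
    filter_upwards [Ioo_mem_nhdsGT one_pos] with s hs using hab s hs
  have hfreq : ∃ᶠ s in 𝓝[≠] (0 : ℝ), ∑' n, s ^ n * a n = ∑' n, s ^ n * b n :=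
    hright.frequently.filter_mono (nhdsWithin_mono _ fun s hs => ne_of_gt hs)
  exact FormalMultilinearSeries.ofScalars_series_injective ℝ ℝ
    (hsa.eq_formalMultilinearSeries_of_eventually hsb
      ((hsa.analyticAt.frequently_eq_iff_eventually_eq hsb.analyticAt).1 hfreq))

theorem measure_enat_ext {ρ σ : Measure ℕ∞} [IsProbabilityMeasure ρ] [IsProbabilityMeasure σ]
    (h : ∀ k : ℕ, ρ {(k : ℕ∞)} = σ {(k : ℕ∞)}) : ρ = σ := by
  have hrange (τ : Measure ℕ∞) : τ {⊤}ᶜ = ∑' k : ℕ, τ {(k : ℕ∞)} := by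
    rw [← measure_iUnion (by simp [Pairwise]) fun _ => measurableSet_singleton _]
    congr 1
    ext k
    simp [ENat.ne_top_iff_exists, lt_top_iff_ne_top]
  refine Measure.ext_of_singleton fun k => ?_
  induction k using ENat.recTopCoe with
  | coe k => exact h k
  | top =>
    rw [← compl_compl {⊤}, prob_compl_eq_one_sub (μ := ρ) .of_discrete,
      prob_compl_eq_one_sub (μ := σ) .of_discrete, hrange, hrange, tsum_congr h]

theorem measure_enat_ext_of_lintegral_enatPow {ρ σ : Measure ℕ∞} [IsProbabilityMeasure ρ]
    [IsProbabilityMeasure σ]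
    (h : ∀ u ∈ Set.Ioo (0 : ℝ≥0∞) 1, ∫⁻ k, enatPow u k ∂ρ = ∫⁻ k, enatPow u k ∂σ) :
    ρ = σ := by
  have hreal (τ : Measure ℕ∞) [IsProbabilityMeasure τ] {s : ℝ} (hs : 0 ≤ s) :
      ∑' k : ℕ, s ^ k * τ.real {(k : ℕ∞)} = (∫⁻ k, enatPow (.ofReal s) k ∂τ).toReal := by
    rw [lintegral_enatPow, ENNReal.tsum_toReal_eq fun k =>
      ENNReal.mul_ne_top (by finiteness) (measure_ne_top _ _)]
    simp [Measure.real, hs]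
  have hnorm (τ : Measure ℕ∞) [IsProbabilityMeasure τ] (k : ℕ) :
      ‖τ.real {(k : ℕ∞)}‖ ≤ 1 := by
    rw [Real.norm_of_nonneg measureReal_nonneg]
    exact measureReal_le_one
  have hmass := eq_of_tsum_pow_mul_eq (hnorm ρ) (hnorm σ) fun s hs => by
    rw [hreal ρ hs.1.le, hreal σ hs.1.le, h _ (by simpa using hs)]
  exact measure_enat_ext fun k => (measureReal_eq_measureReal_iff).1 (congrFun hmass k)

/-- The Poisson distribution of mean `r` on `ℕ∞`, the value space of the counts of a point
pattern. -/
noncomputable def poissonENat (r : ℝ≥0) : Measure ℕ∞ :=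
  (poissonMeasure r).map (Nat.cast : ℕ → ℕ∞)

instance (r : ℝ≥0) : IsProbabilityMeasure (poissonENat r) :=
  Measure.isProbabilityMeasure_map (Measurable.of_discrete).aemeasurable

theorem poissonENat_apply (r : ℝ≥0) (s : Set ℕ∞) :
    poissonENat r s = poissonMeasure r ((Nat.cast : ℕ → ℕ∞) ⁻¹' s) :=
  Measure.map_apply .of_discrete .of_discrete

theorem poissonENat_natCast_singleton (r : ℝ≥0) (k : ℕ) :
    poissonENat r {(k : ℕ∞)} = ENNReal.ofReal (Real.exp (-r) * r ^ k / k.factorial) := by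
  rw [poissonENat_apply, show (Nat.cast : ℕ → ℕ∞) ⁻¹' {(k : ℕ∞)} = {k} by ext; simp,
    poissonMeasure_singleton]

theorem poissonENat_top_singleton (r : ℝ≥0) : poissonENat r {⊤} = 0 := by
  simp [poissonENat_apply, Set.preimage]

theorem lintegral_poissonENat (r : ℝ≥0) (f : ℕ∞ → ℝ≥0∞) :
    ∫⁻ k, f k ∂poissonENat r =
      ∑' k : ℕ, f k * ENNReal.ofReal (Real.exp (-r) * r ^ k / k.factorial) := by
  rw [poissonENat, lintegral_map .of_discrete .of_discrete, lintegral_countable']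
  simp_rw [poissonMeasure_singleton]

theorem hasLaw_poissonENat_of_measure_eq {Ω : Type*} [MeasurableSpace Ω] {P : Measure Ω}
    [IsProbabilityMeasure P] {N : Ω → ℕ∞} (hN : AEMeasurable N P) {r : ℝ≥0}
    (h : ∀ k : ℕ, P {ω | N ω = k} = poissonMeasure r {k}) : HasLaw N (poissonENat r) P where
  aemeasurable := hN
  map_eq := by
    have := Measure.isProbabilityMeasure_map hN
    refine measure_enat_ext fun k => ?_
    rw [Measure.map_apply_of_aemeasurable hN .of_discrete, poissonENat_natCast_singleton,
      ← poissonMeasure_singleton, ← h k]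
    rfl

theorem lintegral_enatPow_poissonENat (r : ℝ≥0) {c : ℝ≥0∞} (hc : c ≤ 1) :
    ∫⁻ k, enatPow (1 - c) k ∂poissonENat r = ENNReal.ofReal (Real.exp (-(c * r).toReal)) := by
  obtain ⟨u, ⟨hu0, hu1⟩, rfl⟩ : ∃ u ∈ Set.Icc (0 : ℝ) 1, c = ENNReal.ofReal (1 - u) :=
    ⟨1 - c.toReal, by simpa using ENNReal.toReal_mono ENNReal.one_ne_top hc, by
      simp [ENNReal.ofReal_toReal (ne_top_of_le_ne_top ENNReal.one_ne_top hc)]⟩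
  have hsum : HasSum (fun k : ℕ => u ^ k * (Real.exp (-r) * r ^ k / k.factorial))
      (Real.exp (-((1 - u) * r))) := by
    have h := (NormedSpace.expSeries_div_hasSum_exp (u * r)).mul_left (Real.exp (-r))
    rw [← Real.exp_eq_exp_ℝ, ← Real.exp_add] at h
    rw [show -((1 - u) * r) = -r + u * r by ring]
    exact h.congr_fun fun k => by ring
  rw [lintegral_poissonENat, ENNReal.toReal_mul, ENNReal.toReal_ofReal (by linarith),
    ENNReal.coe_toReal, ← hsum.tsum_eq,
    ENNReal.ofReal_tsum_of_nonneg (fun k => by positivity) hsum.summable]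
  refine tsum_congr fun k => ?_
  rw [enatPow_natCast, ENNReal.ofReal_mul (by positivity), ENNReal.ofReal_pow hu0,
    ← ENNReal.ofReal_one, ← ENNReal.ofReal_sub _ (by linarith), sub_sub_cancel]

theorem lintegral_coe_poissonENat (r : ℝ≥0) : ∫⁻ k : ℕ∞, (k : ℝ≥0∞) ∂poissonENat r = r := by
  have hsum : HasSum (fun k : ℕ => (k + 1) * (Real.exp (-r) * r ^ (k + 1) / (k + 1).factorial))
      (r : ℝ) := by
    have h := (NormedSpace.expSeries_div_hasSum_exp (r : ℝ)).mul_left (Real.exp (-r) * r)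
    rw [← Real.exp_eq_exp_ℝ, mul_right_comm, ← Real.exp_add, neg_add_cancel, Real.exp_zero,
      one_mul] at h
    refine h.congr_fun fun k => ?_
    rw [Nat.factorial_succ]
    push_cast
    field_simp
    ring
  rw [lintegral_poissonENat, tsum_eq_zero_add' ENNReal.summable]
  conv_rhs => rw [← ENNReal.ofReal_coe_nnreal, ← hsum.tsum_eq,
    ENNReal.ofReal_tsum_of_nonneg (fun k => by positivity) hsum.summable]
  simp only [Nat.cast_zero, ENat.toENNReal_zero, zero_mul, zero_add]
  refine tsum_congr fun k => ?_
  rw [ENNReal.ofReal_mul (by positivity)]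
  norm_cast

theorem poissonENat_Ici_two_le (r : ℝ≥0) : poissonENat r (Set.Ici 2) ≤ (r : ℝ≥0∞) ^ 2 := by
  have hset : Set.Ici (2 : ℕ∞) = ({((0 : ℕ) : ℕ∞)} ∪ {((1 : ℕ) : ℕ∞)})ᶜ := by
    ext k
    induction k using ENat.recTopCoe with
    | top => simp
    | coe k =>
      simp only [Set.mem_Ici, Nat.ofNat_le_cast, Nat.cast_zero, Nat.cast_one,
        Set.union_singleton, Set.mem_compl_iff, Set.mem_insert_iff, Nat.cast_eq_one,
        Set.mem_singleton_iff, Nat.cast_eq_zero, not_or]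
      omega
  rw [← ENNReal.ofReal_toReal (measure_ne_top (poissonENat r) _), ← ENNReal.ofReal_coe_nnreal,
    ← ENNReal.ofReal_pow r.coe_nonneg, hset]
  refine ENNReal.ofReal_le_ofReal ?_
  change (poissonENat r).real _ ≤ _
  rw [probReal_compl_eq_one_sub .of_discrete, measureReal_union (by simp) .of_discrete]
  simp only [Measure.real, poissonENat_natCast_singleton]
  rw [ENNReal.toReal_ofReal (by positivity), ENNReal.toReal_ofReal (by positivity)]
  have hexp := Real.add_one_le_exp (-(r : ℝ))
  simp only [pow_zero, mul_one, Nat.factorial_zero, Nat.cast_one, div_one, pow_one,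
    Nat.factorial_one, tsub_le_iff_right]
  nlinarith [r.coe_nonneg]

theorem hasDerivAt_neg_sum_exp_neg_mul_pow_div_factorial (n : ℕ) (t : ℝ) :
    HasDerivAt (fun t => -∑ k ∈ Finset.range (n + 1), Real.exp (-t) * t ^ k / k.factorial)
      (Real.exp (-t) * t ^ n / n.factorial) t := by
  induction n with
  | zero => simpa using ((hasDerivAt_id t).fun_neg.exp).fun_neg
  | succ n ih =>
    simp_rw [Finset.sum_range_succ _ (n + 1), neg_add]
    have hlast := ((((hasDerivAt_id t).neg).exp.mul (hasDerivAt_pow (n + 1) t)).div_const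
      ((n + 1).factorial : ℝ)).neg
    convert! ih.add hlast using 1
    simp only [Nat.factorial_succ, Nat.cast_mul, Nat.cast_add, Nat.cast_one, Pi.neg_apply, id_eq,
      mul_neg, mul_one, neg_mul, add_tsub_cancel_right]
    field_simp
    ring

theorem tendsto_sum_exp_neg_mul_pow_div_factorial (n : ℕ) :
    Tendsto (fun t : ℝ => ∑ k ∈ Finset.range n, Real.exp (-t) * t ^ k / k.factorial)
      atTop (𝓝 0) := by
  rw [← Finset.sum_const_zero (s := Finset.range n)]
  refine tendsto_finsetSum _ fun k _ => ?_
  simpa [mul_comm] using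
    (Real.tendsto_pow_mul_exp_neg_atTop_nhds_zero k).div_const (k.factorial : ℝ)

theorem upperGamma_div_Gamma {n : ℕ} (hn : 1 ≤ n) {b : ℝ} (hb : 0 ≤ b) :
    upperGamma n b / Real.Gamma n =
      ∑ k ∈ Finset.range n, Real.exp (-b) * b ^ k / k.factorial := by
  obtain ⟨n, rfl⟩ : ∃ m, n = m + 1 := ⟨n - 1, by omega⟩
  have hint := integral_Ioi_of_hasDerivAt_of_nonneg' (a := b)
    (fun t _ => hasDerivAt_neg_sum_exp_neg_mul_pow_div_factorial n t)
    (fun t ht => by have : 0 < t := hb.trans_lt ht; positivity)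
    (tendsto_sum_exp_neg_mul_pow_div_factorial (n + 1)).neg
  simp only [neg_zero, zero_sub, neg_neg] at hint
  rw [upperGamma, Nat.cast_add_one, Real.Gamma_nat_eq_factorial, ← integral_div, ← hint]
  refine setIntegral_congr_fun measurableSet_Ioi fun t _ => ?_
  simp [mul_comm]

theorem poissonENat_real_Iio (r : ℝ≥0) {n : ℕ} (hn : 1 ≤ n) :
    (poissonENat r).real (Set.Iio n) = upperGamma n r / Real.Gamma n := by
  rw [upperGamma_div_Gamma hn r.coe_nonneg, measureReal_def, poissonENat_apply,
    show (Nat.cast : ℕ → ℕ∞) ⁻¹' Set.Iio (n : ℕ∞) = (Finset.range n : Set ℕ) by ext; simp,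
    ← measureReal_def, ← sum_measureReal_singleton]
  refine Finset.sum_congr rfl fun k _ => ?_
  rw [measureReal_def, poissonMeasure_singleton, ENNReal.toReal_ofReal (by positivity)]

end PoissonLaw

section Counts

variable {E : Type*}

theorem toENNReal_pointCount (y : ℕ → E) (B : Set E) :
    (pointCount y B : ℝ≥0∞) = ∑' i, B.indicator 1 (y i) := by
  rw [pointCount, ← ENNReal.tsum_set_one, tsum_subtype _ fun _ => (1 : ℝ≥0∞)]
  exact tsum_congr fun i => by by_cases hi : y i ∈ B <;> simp [hi]

theorem measurable_pointCount [MeasurableSpace E] {B : Set E} (hB : MeasurableSet B) :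
    Measurable fun y : ℕ → E => pointCount y B := by
  have hcoe : Measurable fun y : ℕ → E => (pointCount y B : ℝ≥0∞) := by
    simp_rw [toENNReal_pointCount]
    exact Measurable.tsum fun i => (measurable_one.indicator hB).comp (measurable_pi_apply i)
  refine measurable_to_countable' fun k => ?_
  convert! hcoe (measurableSet_singleton (k : ℝ≥0∞)) using 1
  ext y
  simp

theorem two_le_pointCount {y : ℕ → E} {B : Set E} {i j : ℕ} (hij : i ≠ j) (hi : y i ∈ B)
    (hj : y j ∈ B) : 2 ≤ pointCount y B := by
  rw [← Set.encard_pair hij]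
  exact Set.encard_le_encard (Set.pair_subset hi hj)

end Counts

section InfiniteProduct

/-- The infinite product `∏ i, u i` of numbers in `[0, 1]`, encoded as the infimum of the partial
products (which decrease). -/
noncomputable def infProd (u : ℕ → ℝ≥0∞) : ℝ≥0∞ :=
  ⨅ m, ∏ i ∈ Finset.range m, u i

theorem antitone_prod_range {u : ℕ → ℝ≥0∞} (hu : ∀ i, u i ≤ 1) :
    Antitone fun m => ∏ i ∈ Finset.range m, u i :=
  antitone_nat_of_succ_le fun m => by
    rw [Finset.prod_range_succ]
    exact mul_le_of_le_one_right' (hu m)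

theorem tendsto_prod_range_infProd {u : ℕ → ℝ≥0∞} (hu : ∀ i, u i ≤ 1) :
    Tendsto (fun m => ∏ i ∈ Finset.range m, u i) atTop (𝓝 (infProd u)) :=
  tendsto_atTop_iInf (antitone_prod_range hu)

theorem infProd_le_prod {u : ℕ → ℝ≥0∞} (hu : ∀ i, u i ≤ 1) (J : Finset ℕ) :
    infProd u ≤ ∏ i ∈ J, u i := by
  obtain ⟨M, hM⟩ := J.exists_nat_subset_range
  exact (iInf_le _ M).trans (Finset.prod_le_prod_of_subset_of_le_one' hM fun i _ _ => hu i)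

theorem infProd_eq_prod {u : ℕ → ℝ≥0∞} (hu : ∀ i, u i ≤ 1) {J : Finset ℕ}
    (hJ : ∀ i ∉ J, u i = 1) : infProd u = ∏ i ∈ J, u i := by
  refine le_antisymm (infProd_le_prod hu J) (le_iInf fun m => ?_)
  rw [Finset.prod_subset (Finset.subset_union_left (s₂ := Finset.range m)) fun i _ hi => hJ i hi]
  exact Finset.prod_le_prod_of_subset_of_le_one' Finset.subset_union_right fun i _ _ => hu i

theorem infProd_ite {u : ℝ≥0∞} (hu : u < 1) (J : Set ℕ) [DecidablePred (· ∈ J)] :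
    infProd (fun i => if i ∈ J then u else 1) = enatPow u J.encard := by
  have hle : ∀ i, (if i ∈ J then u else 1) ≤ 1 := fun i => by split_ifs <;> simp [hu.le]
  by_cases hJ : J.Finite
  · rw [infProd_eq_prod hle (J := hJ.toFinset) (by simp +contextual),
      hJ.encard_eq_coe_toFinset_card, enatPow_natCast, ← Finset.prod_const]
    exact Finset.prod_congr rfl fun i hi => by simp_all
  · rw [Set.encard_eq_top hJ, enatPow_top]
    refine le_antisymm (ge_of_tendsto' (ENNReal.tendsto_pow_atTop_nhds_zero_of_lt_one hu)
      fun k => ?_) zero_le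
    obtain ⟨t, htJ, rfl⟩ := Set.Infinite.exists_subset_card_eq hJ k
    refine (infProd_le_prod hle t).trans_eq ?_
    rw [Finset.prod_congr rfl fun i hi => if_pos (htJ hi), Finset.prod_const]

theorem infProd_finsetProd {ι : Type*} {s : Finset ι} {u : ι → ℕ → ℝ≥0∞}
    (hu : ∀ c ∈ s, ∀ i, u c i ≤ 1) :
    infProd (fun i => ∏ c ∈ s, u c i) = ∏ c ∈ s, infProd (u c) := by
  have hle : ∀ i, ∏ c ∈ s, u c i ≤ 1 := fun i => Finset.prod_le_one' fun c hc => hu c hc i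
  refine tendsto_nhds_unique (tendsto_prod_range_infProd hle) ?_
  simp_rw [Finset.prod_comm (t := s)]
  refine ENNReal.tendsto_finsetProd_of_ne_top _
    (fun c hc => tendsto_prod_range_infProd (hu c hc)) fun c hc => ?_
  exact ne_top_of_le_ne_top ENNReal.one_ne_top (by simpa using infProd_le_prod (hu c hc) ∅)

theorem infProd_iInf_of_antitone {u : ℕ → ℕ → ℝ≥0∞} (hanti : Antitone u)
    (hu : ∀ i, u 0 i ≠ ⊤) : infProd (fun i => ⨅ n, u n i) = ⨅ n, infProd (u n) := by
  simp only [infProd]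
  rw [iInf_comm]
  refine iInf_congr fun m => tendsto_nhds_unique ?_ (tendsto_atTop_iInf fun n k hnk =>
    Finset.prod_le_prod' fun i _ => hanti hnk i)
  refine ENNReal.tendsto_finsetProd_of_ne_top _ (fun i _ => ?_) fun i _ => ?_
  · exact tendsto_atTop_iInf fun n k hnk => hanti hnk i
  · exact ne_top_of_le_ne_top (hu i) (iInf_le _ 0)

theorem lintegral_infProd_eq_iInf {Ω : Type*} [MeasurableSpace Ω] {P : Measure Ω}
    [IsProbabilityMeasure P] {u : ℕ → Ω → ℝ≥0∞} (hm : ∀ i, AEMeasurable (u i) P)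
    (hu : ∀ i ω, u i ω ≤ 1) :
    ∫⁻ ω, infProd (fun i => u i ω) ∂P = ⨅ m, ∫⁻ ω, ∏ i ∈ Finset.range m, u i ω ∂P :=
  lintegral_iInf' (fun m => Finset.aemeasurable_fun_prod _ fun i _ => hm i)
    (ae_of_all _ fun ω => antitone_prod_range fun i => hu i ω) (by simp)

theorem aemeasurable_infProd {Ω : Type*} [MeasurableSpace Ω] {P : Measure Ω}
    {u : ℕ → Ω → ℝ≥0∞} (hm : ∀ i, AEMeasurable (u i) P) :
    AEMeasurable (fun ω => infProd fun i => u i ω) P :=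
  .iInf fun _ => Finset.aemeasurable_fun_prod _ fun i _ => hm i

end InfiniteProduct

section PoissonProcess

variable {Ω E : Type*} [MeasurableSpace Ω] [MeasurableSpace E] {P : Measure Ω} {μ : Measure E}
  {x : ℕ → Ω → E}

/-- The random points `x 0, x 1, …` have Poisson counts with intensity measure `μ`: the
one-dimensional part of `IsPoissonProcess`. -/
structure HasPoissonCounts (P : Measure Ω) (μ : Measure E) (x : ℕ → Ω → E) : Prop where
  aemeasurable : ∀ i, AEMeasurable (x i) P
  count_law : ∀ B, MeasurableSet B → μ B ≠ ⊤ →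
    HasLaw (fun ω => pointCount (fun i => x i ω) B) (poissonENat (μ B).toNNReal) P

/-- The random points `x 0, x 1, …` enumerate a Poisson point process with intensity measure
`μ`: counts of sets of finite intensity are Poisson, and counts of disjoint such sets are
independent. -/
structure IsPoissonProcess (P : Measure Ω) (μ : Measure E) (x : ℕ → Ω → E) : Prop
    extends HasPoissonCounts P μ x where
  count_indep : ∀ (m : ℕ) (B : Fin m → Set E), (∀ j, MeasurableSet (B j)) →
    (∀ j, μ (B j) ≠ ⊤) → Pairwise (fun j l => Disjoint (B j) (B l)) →
    iIndepFun (fun j ω => pointCount (fun i => x i ω) (B j)) P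

/-- The random points `x 0, x 1, …` have the probability generating functional
`v ↦ E[∏ i, (1 - v (x i))] = exp (-∫ v dμ)` of a Poisson point process with intensity `μ`. Unlike
the finite-dimensional distributions, this characterization is preserved by independent marking
through a direct computation. -/
structure HasPoissonPGFL (P : Measure Ω) (μ : Measure E) (x : ℕ → Ω → E) : Prop where
  aemeasurable : ∀ i, AEMeasurable (x i) P
  lintegral_infProd : ∀ v : E → ℝ≥0∞, Measurable v → (∀ y, v y ≤ 1) → ∫⁻ y, v y ∂μ ≠ ⊤ →
    ∫⁻ ω, infProd (fun i => 1 - v (x i ω)) ∂P = ENNReal.ofReal (Real.exp (-(∫⁻ y, v y ∂μ).toReal))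

theorem aemeasurable_pointCount (hx : ∀ i, AEMeasurable (x i) P) {B : Set E}
    (hB : MeasurableSet B) : AEMeasurable (fun ω => pointCount (fun i => x i ω) B) P :=
  (measurable_pointCount hB).comp_aemeasurable (aemeasurable_pi_lambda _ hx)

theorem IsHomogeneousPPP.isPoissonProcess [IsProbabilityMeasure P] {lam : ℝ} (hlam : 0 < lam)
    {x : ℕ → Ω → Plane} (hx : IsHomogeneousPPP P lam x) :
    IsPoissonProcess P (ENNReal.ofReal lam • (volume : Measure Plane)) x := by
  have hlam' : ENNReal.ofReal lam ≠ 0 := by simpa using hlam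
  have hvol {B : Set Plane} (hB : (ENNReal.ofReal lam • volume) B ≠ ⊤) : volume B ≠ ⊤ := by
    intro h
    rw [Measure.smul_apply, h, smul_eq_mul, ENNReal.mul_top hlam'] at hB
    exact hB rfl
  refine ⟨⟨fun i => (hx.measurable i).aemeasurable, fun B hB hBfin => ?_⟩, fun m B hB hBfin hdisj =>
    hx.count_indep m B hB (fun j => hvol (hBfin j)) hdisj⟩
  refine hasLaw_poissonENat_of_measure_eq
    (aemeasurable_pointCount (fun i => (hx.measurable i).aemeasurable) hB) fun k => ?_
  rw [hx.count_law B hB (hvol hBfin), Measure.smul_apply, smul_eq_mul, ENNReal.toNNReal_mul,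
    Real.toNNReal_mul hlam.le, ENNReal.toNNReal_toReal_eq]
  rfl

theorem lintegral_prod_of_iIndepFun {ι : Type*} {s : Finset ι} {X : ι → Ω → ℝ≥0∞}
    (hX : iIndepFun X P) (hm : ∀ i, AEMeasurable (X i) P) :
    ∫⁻ ω, ∏ i ∈ s, X i ω ∂P = ∏ i ∈ s, ∫⁻ ω, X i ω ∂P := by
  have hmk : ∀ᵐ ω ∂P, ∀ i ∈ s, X i ω = (hm i).mk (X i) ω :=
    (ae_ball_iff s.countable_toSet).2 fun i _ => (hm i).ae_eq_mk
  calc ∫⁻ ω, ∏ i ∈ s, X i ω ∂P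
      = ∫⁻ ω, ∏ i ∈ s, (hm i).mk (X i) ω ∂P :=
        lintegral_congr_ae <| hmk.mono fun ω hω => Finset.prod_congr rfl hω
    _ = ∏ i ∈ s, ∫⁻ ω, (hm i).mk (X i) ω ∂P :=
        lintegral_prod_eq_prod_lintegral_of_indepFun s _
          (hX.congr fun i => (hm i).ae_eq_mk) fun i => (hm i).measurable_mk
    _ = ∏ i ∈ s, ∫⁻ ω, X i ω ∂P :=
        Finset.prod_congr rfl fun i _ => lintegral_congr_ae (hm i).ae_eq_mk.symm

theorem IsPoissonProcess.iIndepFun_pointCount (hx : IsPoissonProcess P μ x) {ι : Type*}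
    [Finite ι] {B : ι → Set E} (hB : ∀ j, MeasurableSet (B j)) (hfin : ∀ j, μ (B j) ≠ ⊤)
    (hdisj : Pairwise fun j l => Disjoint (B j) (B l)) :
    iIndepFun (fun j ω => pointCount (fun i => x i ω) (B j)) P := by
  obtain ⟨m, ⟨e⟩⟩ := Finite.exists_equiv_fin ι
  have h := (hx.count_indep m (B ∘ e.symm) (fun j => hB _) (fun j => hfin _)
    (hdisj.comp_of_injective e.symm.injective)).precomp e.injective
  simpa [Function.comp_def] using h

theorem infProd_one_sub_simpleFunc (v : SimpleFunc E ℝ≥0∞) (y : ℕ → E) :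
    infProd (fun i => 1 - v (y i)) =
      ∏ c ∈ v.range.filter (· ≠ 0), enatPow (1 - c) (pointCount y (v ⁻¹' {c})) := by
  classical
  have hfactor : ∀ a, 1 - v a =
      ∏ c ∈ v.range.filter (· ≠ 0), if v a = c then 1 - c else 1 := fun a => by
    by_cases ha : v a = 0 <;> simp [Finset.prod_ite_eq, ha]
  simp_rw [hfactor]
  rw [infProd_finsetProd fun c _ i => by split_ifs <;> simp]
  refine Finset.prod_congr rfl fun c hc => ?_
  obtain ⟨⟨a, rfl⟩, hc0⟩ : (∃ a, v a = c) ∧ c ≠ 0 := by simpa using hc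
  exact infProd_ite (ENNReal.sub_lt_self ENNReal.one_ne_top one_ne_zero hc0)
    {i | v (y i) = v a}

theorem IsPoissonProcess.lintegral_prod_enatPow (hx : IsPoissonProcess P μ x) {ι : Type*}
    [Fintype ι] {B : ι → Set E} (hB : ∀ j, MeasurableSet (B j)) (hfin : ∀ j, μ (B j) ≠ ⊤)
    (hdisj : Pairwise fun j l => Disjoint (B j) (B l)) {c : ι → ℝ≥0∞} (hc : ∀ j, c j ≤ 1) :
    ∫⁻ ω, ∏ j, enatPow (1 - c j) (pointCount (fun i => x i ω) (B j)) ∂P =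
      ENNReal.ofReal (Real.exp (-(∑ j, c j * μ (B j)).toReal)) := by
  have hindep := (hx.iIndepFun_pointCount hB hfin hdisj).comp
    (fun j => enatPow (1 - c j)) fun _ => .of_discrete
  have hfactor (j : ι) : ∫⁻ ω, enatPow (1 - c j) (pointCount (fun i => x i ω) (B j)) ∂P =
      ENNReal.ofReal (Real.exp (-(c j * μ (B j)).toReal)) := by
    rw [(hx.count_law _ (hB j) (hfin j)).lintegral_comp (Measurable.of_discrete).aemeasurable,
      lintegral_enatPow_poissonENat _ (hc j), ENNReal.coe_toNNReal (hfin j)]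
  refine (lintegral_prod_of_iIndepFun hindep fun j => Measurable.of_discrete.comp_aemeasurable
    (aemeasurable_pointCount hx.aemeasurable (hB j))).trans ?_
  simp only [Function.comp_apply, hfactor]
  rw [← ENNReal.ofReal_prod_of_nonneg fun _ _ => (Real.exp_pos _).le, ← Real.exp_sum,
    Finset.sum_neg_distrib, ← ENNReal.toReal_sum fun j _ =>
      ENNReal.mul_ne_top (ne_top_of_le_ne_top ENNReal.one_ne_top (hc j)) (hfin j)]

theorem IsPoissonProcess.lintegral_infProd_simpleFunc (hx : IsPoissonProcess P μ x)
    (v : SimpleFunc E ℝ≥0∞) (hv : ∀ y, v y ≤ 1) (hfin : ∫⁻ y, v y ∂μ ≠ ⊤) :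
    ∫⁻ ω, infProd (fun i => 1 - v (x i ω)) ∂P =
      ENNReal.ofReal (Real.exp (-(∫⁻ y, v y ∂μ).toReal)) := by
  set S := v.range.filter (· ≠ 0)
  have hle : ∀ c ∈ S, c ≤ 1 := by simpa [S] using fun y _ => hv y
  have hfibre : ∀ c ∈ S, μ (v ⁻¹' {c}) ≠ ⊤ := fun c hc =>
    ((SimpleFunc.FinMeasSupp.of_lintegral_ne_top
      (by rwa [← SimpleFunc.lintegral_eq_lintegral])).meas_preimage_singleton_ne_zero
        (Finset.mem_filter.1 hc).2).ne
  have hint : ∫⁻ y, v y ∂μ = ∑ c ∈ S, c * μ (v ⁻¹' {c}) := by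
    rw [SimpleFunc.lintegral_eq_lintegral, SimpleFunc.lintegral,
      Finset.sum_filter_of_ne fun c _ hc => left_ne_zero_of_mul hc]
  simp_rw [infProd_one_sub_simpleFunc v]
  rw [hint, ← Finset.sum_coe_sort S fun c => c * μ (v ⁻¹' {c}),
    ← hx.lintegral_prod_enatPow (fun c : S => v.measurableSet_fiber c) (fun c => hfibre c c.2)
      (fun c d hcd => Disjoint.preimage v (by simpa using Subtype.coe_ne_coe.2 hcd))
      (fun c => hle c c.2)]
  exact lintegral_congr fun ω => (Finset.prod_coe_sort S fun c =>
    enatPow (1 - c) (pointCount (fun i => x i ω) (v ⁻¹' {c}))).symm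

theorem infProd_one_sub_eq_iInf_eapprox {v : E → ℝ≥0∞} (hv : Measurable v) (y : ℕ → E) :
    infProd (fun i => 1 - v (y i)) =
      ⨅ n, infProd fun i => 1 - SimpleFunc.eapprox v n (y i) := by
  have hsub (z : E) : 1 - v z = ⨅ n, (1 - SimpleFunc.eapprox v n z) := by
    rw [← ENNReal.sub_iSup ENNReal.one_ne_top, SimpleFunc.iSup_eapprox_apply hv]
  simp_rw [hsub]
  exact infProd_iInf_of_antitone (u := fun n i => 1 - SimpleFunc.eapprox v n (y i))
    (fun n k hnk i => tsub_le_tsub_left (SimpleFunc.monotone_eapprox v hnk _) _) (by simp)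

theorem IsPoissonProcess.hasPoissonPGFL (hx : IsPoissonProcess P μ x) :
    HasPoissonPGFL P μ x where
  aemeasurable := hx.aemeasurable
  lintegral_infProd v hvm hv hfin := by
    let w := SimpleFunc.eapprox v
    have hwmono : Monotone fun n y => w n y := fun n k hnk => SimpleFunc.monotone_eapprox v hnk
    have hwle (n : ℕ) (y : E) : w n y ≤ v y := by
      rw [← SimpleFunc.iSup_eapprox_apply hvm]
      exact le_iSup (fun n => w n y) n
    have hwfin (n : ℕ) : ∫⁻ y, w n y ∂μ ≠ ⊤ := ne_top_of_le_ne_top hfin (lintegral_mono (hwle n))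
    let G : ℕ → Ω → ℝ≥0∞ := fun n ω => infProd fun i => 1 - w n (x i ω)
    have hGanti : Antitone G := fun n k hnk ω => iInf_mono fun m =>
      Finset.prod_le_prod' fun i _ => tsub_le_tsub_left (hwmono hnk _) _
    have hGint (n : ℕ) : ∫⁻ ω, G n ω ∂P =
        ENNReal.ofReal (Real.exp (-(∫⁻ y, w n y ∂μ).toReal)) :=
      hx.lintegral_infProd_simpleFunc (w n) (fun y => (hwle n y).trans (hv y)) (hwfin n)
    have hGm (n : ℕ) : AEMeasurable (G n) P := aemeasurable_infProd fun i =>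
      ((w n).measurable.comp_aemeasurable (hx.aemeasurable i)).const_sub 1
    have hlim : Tendsto (fun n => ∫⁻ y, w n y ∂μ) atTop (𝓝 (∫⁻ y, v y ∂μ)) :=
      lintegral_tendsto_of_tendsto_of_monotone (fun n => (w n).measurable.aemeasurable)
        (ae_of_all _ fun y n k hnk => hwmono hnk y)
        (ae_of_all _ fun y => SimpleFunc.tendsto_eapprox hvm y)
    rw [lintegral_congr fun ω => infProd_one_sub_eq_iInf_eapprox hvm fun i => x i ω,
      lintegral_iInf' hGm (ae_of_all _ fun ω n k hnk => hGanti hnk ω)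
      (by rw [hGint]; exact ENNReal.ofReal_ne_top)]
    refine tendsto_nhds_unique
      (tendsto_atTop_iInf fun n k hnk => lintegral_mono (hGanti hnk)) ?_
    simp_rw [hGint]
    exact ENNReal.tendsto_ofReal ((Real.continuous_exp.tendsto _).comp
      ((ENNReal.tendsto_toReal hfin).comp hlim).neg)

theorem HasPoissonPGFL.hasPoissonCounts [IsProbabilityMeasure P] (hx : HasPoissonPGFL P μ x) :
    HasPoissonCounts P μ x where
  aemeasurable := hx.aemeasurable
  count_law B hB hfin := by
    classical
    have hcount := aemeasurable_pointCount hx.aemeasurable hB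
    have := Measure.isProbabilityMeasure_map hcount
    refine ⟨hcount, measure_enat_ext_of_lintegral_enatPow fun u ⟨_, hu1⟩ => ?_⟩
    let v : E → ℝ≥0∞ := B.indicator fun _ => 1 - u
    have hv : ∀ y, v y ≤ 1 := fun y =>
      Set.indicator_le' (fun _ _ => tsub_le_self) (fun _ _ => zero_le) y
    have hvint : ∫⁻ y, v y ∂μ = (1 - u) * μ B := lintegral_indicator_const hB _
    have hvsub : ∀ y, 1 - v y = if y ∈ B then u else 1 := fun y => by
      by_cases hy : y ∈ B <;> simp [v, hy, ENNReal.sub_sub_cancel, hu1.le]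
    have hpgfl := hx.lintegral_infProd v (measurable_const.indicator hB) hv
      (by rw [hvint]; finiteness)
    simp_rw [hvsub] at hpgfl
    rw [hvint, ← ENNReal.coe_toNNReal hfin, ← lintegral_enatPow_poissonENat _ tsub_le_self,
      ENNReal.sub_sub_cancel ENNReal.one_ne_top hu1.le] at hpgfl
    rw [lintegral_map' (Measurable.of_discrete).aemeasurable hcount, ← hpgfl]
    exact lintegral_congr fun ω => (infProd_ite hu1 {i | x i ω ∈ B}).symm

theorem HasPoissonCounts.map {F : Type*} [MeasurableSpace F] (hx : HasPoissonCounts P μ x)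
    {f : E → F} (hf : Measurable f) : HasPoissonCounts P (μ.map f) (fun i ω => f (x i ω)) where
  aemeasurable i := hf.comp_aemeasurable (hx.aemeasurable i)
  count_law B hB hfin := by
    rw [Measure.map_apply hf hB] at hfin ⊢
    exact hx.count_law (f ⁻¹' B) (hf hB) hfin

end PoissonProcess

section Marking

variable {Ω E F : Type*} [MeasurableSpace Ω] [MeasurableSpace E] [MeasurableSpace F]
  {P : Measure Ω} [IsProbabilityMeasure P] {μ : Measure E} {ν : Measure F}
  {x : ℕ → Ω → E} {h : ℕ → Ω → F}

theorem lintegral_prod_range_marks (hx : ∀ i, AEMeasurable (x i) P)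
    (hlaw : ∀ i, HasLaw (h i) ν P) (hindep : iIndepFun h P)
    (hxh : IndepFun (fun ω i => x i ω) (fun ω i => h i ω) P) {f : E × F → ℝ≥0∞}
    (hf : Measurable f) (m : ℕ) :
    ∫⁻ ω, ∏ i ∈ Finset.range m, f (x i ω, h i ω) ∂P =
      ∫⁻ ω, ∏ i ∈ Finset.range m, ∫⁻ t, f (x i ω, t) ∂ν ∂P := by
  have hX : AEMeasurable (fun ω i => x i ω) P := aemeasurable_pi_lambda _ hx
  have hH : AEMeasurable (fun ω i => h i ω) P :=
    aemeasurable_pi_lambda _ fun i => (hlaw i).aemeasurable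
  have := Measure.isProbabilityMeasure_map hH
  have := Measure.isProbabilityMeasure_map hX
  have hfi (i : ℕ) : Measurable fun p : (ℕ → E) × (ℕ → F) => f (p.1 i, p.2 i) :=
    hf.comp (by fun_prop)
  have hF : Measurable fun p : (ℕ → E) × (ℕ → F) => ∏ i ∈ Finset.range m, f (p.1 i, p.2 i) :=
    Finset.measurable_fun_prod _ fun i _ => hfi i
  have hsection (a : E) : Measurable fun t => f (a, t) := hf.comp measurable_prodMk_left
  calc ∫⁻ ω, ∏ i ∈ Finset.range m, f (x i ω, h i ω) ∂P
      = ∫⁻ p, ∏ i ∈ Finset.range m, f (p.1 i, p.2 i)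
          ∂(P.map fun ω i => x i ω).prod (P.map fun ω i => h i ω) := by
        rw [← (indepFun_iff_map_prod_eq_prod_map_map hX hH).1 hxh,
          lintegral_map' hF.aemeasurable (hX.prodMk hH)]
    _ = ∫⁻ ω, ∫⁻ ω', ∏ i ∈ Finset.range m, f (x i ω, h i ω') ∂P ∂P := by
        rw [lintegral_prod _ hF.aemeasurable,
          lintegral_map' hF.lintegral_prod_right'.aemeasurable hX]
        exact lintegral_congr fun ω =>
          lintegral_map' (hF.comp measurable_prodMk_left).aemeasurable hH
    _ = ∫⁻ ω, ∏ i ∈ Finset.range m, ∫⁻ t, f (x i ω, t) ∂ν ∂P := lintegral_congr fun ω => by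
        refine (lintegral_prod_of_iIndepFun
          (hindep.comp (fun i t => f (x i ω, t)) fun i => hsection _)
          fun i => (hsection _).comp_aemeasurable (hlaw i).aemeasurable).trans ?_
        exact Finset.prod_congr rfl fun i _ =>
          (hlaw i).lintegral_comp (hsection (x i ω)).aemeasurable

theorem HasPoissonPGFL.prodMk [IsProbabilityMeasure ν] (hx : HasPoissonPGFL P μ x)
    (hlaw : ∀ i, HasLaw (h i) ν P) (hindep : iIndepFun h P)
    (hxh : IndepFun (fun ω i => x i ω) (fun ω i => h i ω) P) :
    HasPoissonPGFL P (μ.prod ν) fun i ω => (x i ω, h i ω) where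
  aemeasurable i := (hx.aemeasurable i).prodMk (hlaw i).aemeasurable
  lintegral_infProd w hwm hw hfin := by
    have hpair (i : ℕ) : AEMeasurable (fun ω => (x i ω, h i ω)) P :=
      (hx.aemeasurable i).prodMk (hlaw i).aemeasurable
    let v : E → ℝ≥0∞ := fun y => ∫⁻ t, w (y, t) ∂ν
    have hvm : Measurable v := hwm.lintegral_prod_right'
    have hv (y : E) : v y ≤ 1 := by
      simpa using lintegral_mono (μ := ν) fun t => hw (y, t)
    have hint : ∫⁻ p, w p ∂μ.prod ν = ∫⁻ y, v y ∂μ := lintegral_prod _ hwm.aemeasurable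
    have hsub (y : E) : ∫⁻ t, (1 - w (y, t)) ∂ν = 1 - v y := by
      have hsection : Measurable fun t => w (y, t) := hwm.comp measurable_prodMk_left
      rw [lintegral_sub hsection
        (ne_top_of_le_ne_top ENNReal.one_ne_top (hv y)) (ae_of_all _ fun t => hw (y, t))]
      simp [v]
    have hpgfl := hx.lintegral_infProd v hvm hv (hint ▸ hfin)
    rw [lintegral_infProd_eq_iInf (u := fun i ω => 1 - v (x i ω))
      (fun i => (hvm.comp_aemeasurable (hx.aemeasurable i)).const_sub 1)
      (fun i ω => tsub_le_self)] at hpgfl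
    rw [lintegral_infProd_eq_iInf (u := fun i ω => 1 - w (x i ω, h i ω))
      (fun i => (hwm.comp_aemeasurable (hpair i)).const_sub 1)
      (fun i ω => tsub_le_self), hint, ← hpgfl]
    refine iInf_congr fun m => ?_
    rw [lintegral_prod_range_marks hx.aemeasurable hlaw hindep hxh
      (f := fun p => 1 - w p) (hwm.const_sub 1)]
    simp_rw [hsub]

end Marking

section SamplePaths

variable {Ω E : Type*} [MeasurableSpace Ω] [MeasurableSpace E] {P : Measure Ω} {μ : Measure E}
  {x : ℕ → Ω → E}

theorem HasPoissonCounts.lintegral_pointCount (hx : HasPoissonCounts P μ x) {B : Set E}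
    (hB : MeasurableSet B) (hfin : μ B ≠ ⊤) :
    ∫⁻ ω, (pointCount (fun i => x i ω) B : ℝ≥0∞) ∂P = μ B := by
  rw [(hx.count_law B hB hfin).lintegral_comp (f := fun k : ℕ∞ => (k : ℝ≥0∞))
    (Measurable.of_discrete).aemeasurable, lintegral_coe_poissonENat, ENNReal.coe_toNNReal hfin]

theorem HasPoissonCounts.ae_finite (hx : HasPoissonCounts P μ x) {B : Set E}
    (hB : MeasurableSet B) (hfin : μ B ≠ ⊤) : ∀ᵐ ω ∂P, {i | x i ω ∈ B}.Finite := by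
  have htop := (hx.count_law B hB hfin).measure_eq (p := fun k => k = ⊤)
    (measurableSet_singleton ⊤)
  rw [Set.ofPred_eq_eq_singleton, poissonENat_top_singleton] at htop
  filter_upwards [measure_eq_zero_iff_ae_notMem.1 htop] with ω hω
  exact Set.encard_ne_top_iff.1 hω

theorem HasPoissonCounts.ae_forall_notMem (hx : HasPoissonCounts P μ x) {B : Set E}
    (hB : MeasurableSet B) (hnull : μ B = 0) : ∀ᵐ ω ∂P, ∀ i, x i ω ∉ B := by
  have hmean := hx.lintegral_pointCount hB (by simp [hnull])
  have hcount : AEMeasurable (fun ω => (pointCount (fun i => x i ω) B : ℝ≥0∞)) P :=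
    Measurable.of_discrete.comp_aemeasurable (aemeasurable_pointCount hx.aemeasurable hB)
  rw [hnull, lintegral_eq_zero_iff' hcount] at hmean
  filter_upwards [hmean] with ω hω i hi
  have hempty : {i | x i ω ∈ B} = ∅ := by simpa [pointCount] using hω
  exact hempty.le hi

theorem HasPoissonCounts.measure_two_le_pointCount_le (hx : HasPoissonCounts P μ x) {B : Set E}
    (hB : MeasurableSet B) (hfin : μ B ≠ ⊤) :
    P {ω | 2 ≤ pointCount (fun i => x i ω) B} ≤ μ B ^ 2 := by
  have h := (hx.count_law B hB hfin).measure_eq (p := fun k => 2 ≤ k) .of_discrete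
  calc P {ω | 2 ≤ pointCount (fun i => x i ω) B} = poissonENat (μ B).toNNReal (Set.Ici 2) := h
    _ ≤ μ B ^ 2 := by simpa [ENNReal.coe_toNNReal hfin] using
        poissonENat_Ici_two_le (μ B).toNNReal

theorem HasPoissonCounts.ae_infinite (hx : HasPoissonCounts P μ x) {B : ℕ → Set E}
    (hB : ∀ k, MeasurableSet (B k)) (hfin : ∀ k, μ (B k) ≠ ⊤)
    (hlim : Tendsto (fun k => μ (B k)) atTop (𝓝 ⊤)) :
    ∀ᵐ ω ∂P, {i | x i ω ∈ ⋃ k, B k}.Infinite := by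
  have hhalf : (1 - 2⁻¹ : ℝ≥0∞) = 2⁻¹ := ENNReal.one_sub_inv_two
  have hbound (k : ℕ) : ∫⁻ ω, enatPow 2⁻¹ (pointCount (fun i => x i ω) (⋃ k, B k)) ∂P ≤
      ENNReal.ofReal (Real.exp (-(2⁻¹ * μ (B k)).toReal)) := by
    rw [← ENNReal.coe_toNNReal (hfin k), ← lintegral_enatPow_poissonENat _ (by simp), hhalf,
      ← (hx.count_law _ (hB k) (hfin k)).lintegral_comp (Measurable.of_discrete).aemeasurable]
    exact lintegral_mono fun ω => enatPow_antitone (by simp) <|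
      Set.encard_le_encard fun i hi => Set.mem_iUnion_of_mem k hi
  have hexp : Tendsto (fun k => ENNReal.ofReal (Real.exp (-(2⁻¹ * μ (B k)).toReal)))
      atTop (𝓝 0) := by
    have hreal : Tendsto (fun k => (2⁻¹ * μ (B k)).toReal) atTop atTop := by
      rw [← ENNReal.tendsto_ofReal_nhds_top]
      have hne (k : ℕ) : 2⁻¹ * μ (B k) ≠ ⊤ := ENNReal.mul_ne_top (by simp) (hfin k)
      simp only [ENNReal.ofReal_toReal (hne _)]
      simpa [ENNReal.mul_top] using ENNReal.Tendsto.const_mul (a := 2⁻¹) hlim (.inl (by simp))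
    simpa using ENNReal.tendsto_ofReal (Real.tendsto_exp_neg_atTop_nhds_zero.comp hreal)
  have hzero := le_antisymm (ge_of_tendsto' hexp hbound) zero_le
  have hmeas : AEMeasurable
      (fun ω => enatPow 2⁻¹ (pointCount (fun i => x i ω) (⋃ k, B k))) P :=
    Measurable.of_discrete.comp_aemeasurable (aemeasurable_pointCount hx.aemeasurable (.iUnion hB))
  rw [lintegral_eq_zero_iff' hmeas] at hzero
  filter_upwards [hzero] with ω hω
  exact Set.encard_eq_top_iff.1 ((enatPow_eq_zero_iff (by simp)).1 hω)

end SamplePaths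

section SimplePoints

variable {Ω E : Type*} [MeasurableSpace Ω] [MeasurableSpace E] {P : Measure Ω} {μ : Measure E}
  {x : ℕ → Ω → E}

theorem sum_measure_fiber_sq {κ : Type*} [Fintype κ] [MeasurableSpace κ]
    [MeasurableSingletonClass κ] (μ : Measure E) [SFinite μ] {g : E → κ} (hg : Measurable g) :
    ∑ c, μ (g ⁻¹' {c}) ^ 2 = (μ.prod μ) {p | g p.1 = g p.2} := by
  have hunion : {p : E × E | g p.1 = g p.2} = ⋃ c, (g ⁻¹' {c}) ×ˢ (g ⁻¹' {c}) := by
    ext p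
    simp [eq_comm]
  have hmeas (c : κ) : MeasurableSet (g ⁻¹' {c}) := hg (measurableSet_singleton c)
  have hdisj : Pairwise fun c d => Disjoint ((g ⁻¹' {c}) ×ˢ (g ⁻¹' {c}))
      ((g ⁻¹' {d}) ×ˢ (g ⁻¹' {d})) := fun c d hcd =>
    Set.disjoint_prod.2 (.inl (Disjoint.preimage g (by simpa using hcd)))
  rw [hunion, measure_iUnion hdisj fun c => (hmeas c).prod (hmeas c), tsum_fintype]
  simp only [Measure.prod_prod, sq]

theorem tendsto_sum_measure_prefix_sq (μ : Measure E) [IsFiniteMeasure μ] (hμ : ∀ a, μ {a} = 0)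
    {f : E → ℕ → Bool} (hf : Measurable f) (hinj : Function.Injective f) :
    Tendsto (fun n => ∑ c : Fin n → Bool, μ ((fun a (i : Fin n) => f a i) ⁻¹' {c}) ^ 2)
      atTop (𝓝 0) := by
  let S : ℕ → Set (E × E) := fun n =>
    {p | (fun i : Fin n => f p.1 i) = fun i : Fin n => f p.2 i}
  have hprefix (n : ℕ) : Measurable fun a (i : Fin n) => f a i := by fun_prop
  have hS (n : ℕ) : MeasurableSet (S n) := measurableSet_eq_fun
    ((hprefix n).comp measurable_fst) ((hprefix n).comp measurable_snd)
  have hanti : Antitone S := fun m n hmn p hp => funext fun i =>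
    congrFun (Set.mem_ofPred_eq ▸ hp) (Fin.castLE hmn i)
  have hdiag : ⋂ n, S n = Set.diagonal E := by
    refine Set.eq_of_subset_of_subset (fun p hp => hinj (funext fun i => ?_)) fun p hp => ?_
    · exact congrFun (Set.mem_ofPred_eq ▸ Set.mem_iInter.1 hp (i + 1)) (Fin.last i)
    · exact Set.mem_iInter.2 fun n => by simp [S, Set.mem_diagonal_iff.1 hp]
  have hnull : (μ.prod μ) (⋂ n, S n) = 0 := by
    have hslice (a : E) : Prod.mk a ⁻¹' Set.diagonal E = {a} := by ext b; simp [eq_comm]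
    rw [Measure.prod_apply (.iInter hS), hdiag]
    simp [hslice, hμ]
  simp_rw [sum_measure_fiber_sq μ (hprefix _)]
  exact hnull ▸ tendsto_measure_iInter_atTop (fun n => (hS n).nullMeasurableSet) hanti
    ⟨0, measure_ne_top _ _⟩

theorem HasPoissonCounts.ae_injOn [MeasurableSpace.CountablySeparated E]
    (hx : HasPoissonCounts P μ x) {B : Set E} (hB : MeasurableSet B) (hfin : μ B ≠ ⊤)
    (hatom : ∀ a ∈ B, μ {a} = 0) : ∀ᵐ ω ∂P, Set.InjOn (fun i => x i ω) {i | x i ω ∈ B} := by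
  obtain ⟨f, hf, hinj⟩ := MeasurableSpace.measurable_injection_nat_bool_of_countablySeparated E
  let cell (n : ℕ) (c : Fin n → Bool) : Set E := (fun a (i : Fin n) => f a i) ⁻¹' {c}
  have hcell (n : ℕ) (c : Fin n → Bool) : MeasurableSet (cell n c) :=
    (by fun_prop : Measurable fun a (i : Fin n) => f a i) (measurableSet_singleton c)
  have hsub (n : ℕ) : {ω | ¬ Set.InjOn (fun i => x i ω) {i | x i ω ∈ B}} ⊆
      ⋃ c, {ω | 2 ≤ pointCount (fun i => x i ω) (cell n c ∩ B)} := by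
    intro ω hω
    simp only [Set.InjOn, Set.mem_ofPred_eq, not_forall] at hω
    obtain ⟨i, hi, j, hj, heq, hij⟩ := hω
    refine Set.mem_iUnion.2 ⟨fun k => f (x i ω) k, two_le_pointCount hij ⟨rfl, hi⟩ ⟨?_, hj⟩⟩
    simp [cell, heq]
  have hbound (n : ℕ) : P {ω | ¬ Set.InjOn (fun i => x i ω) {i | x i ω ∈ B}} ≤
      ∑ c, μ.restrict B (cell n c) ^ 2 := by
    refine (measure_mono (hsub n)).trans ((measure_iUnion_fintype_le P _).trans ?_)
    refine Finset.sum_le_sum fun c _ => ?_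
    rw [Measure.restrict_apply (hcell n c)]
    exact hx.measure_two_le_pointCount_le ((hcell n c).inter hB)
      (ne_top_of_le_ne_top hfin (measure_mono Set.inter_subset_right))
  have : IsFiniteMeasure (μ.restrict B) := isFiniteMeasure_restrict.2 hfin
  have hdiffuse (a : E) : μ.restrict B {a} = 0 := by
    rw [Measure.restrict_apply' hB]
    by_cases ha : a ∈ B
    · exact measure_mono_null Set.inter_subset_left (hatom a ha)
    · simp [ha]
  exact le_antisymm (ge_of_tendsto' (tendsto_sum_measure_prefix_sq _ hdiffuse hf hinj) hbound)
    zero_le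

end SimplePoints

section SectorArea

theorem measurable_toIcoMod {p : ℝ} (hp : 0 < p) (a : ℝ) : Measurable (toIcoMod hp a) := by
  simp_rw [funext (toIcoMod_eq_add_fract_mul hp a)]
  fun_prop

theorem volume_toIcoMod_le_inter_Ioo {p φ : ℝ} (hp : 0 < p) (hφp : φ ≤ p) (a : ℝ) :
    volume ({θ | toIcoMod hp 0 θ ≤ φ} ∩ Set.Ioo a (a + p)) = ENNReal.ofReal φ := by
  set A := {θ | toIcoMod hp 0 θ ≤ φ} with hA
  have hAm : MeasurableSet A := measurableSet_le (measurable_toIcoMod hp 0) measurable_const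
  have hperiodic (g : AddSubgroup.zmultiples p) : (fun θ => g +ᵥ θ) ⁻¹' A = A := by
    obtain ⟨_, n, rfl⟩ := g
    ext θ
    simp [hA, AddSubgroup.vadd_def]
  calc volume (A ∩ Set.Ioo a (a + p)) = volume (A ∩ Set.Ioc a (a + p)) :=
        measure_congr (.inter (ae_eq_refl A) Ioo_ae_eq_Ioc)
    _ = volume (A ∩ Set.Ioc 0 (0 + p)) := (isAddFundamentalDomain_Ioc hp a).measure_set_eq
        (isAddFundamentalDomain_Ioc hp 0) hAm hperiodic
    _ = volume (A ∩ Set.Ico 0 p) := by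
        rw [zero_add]
        exact measure_congr (.inter (ae_eq_refl A) Ico_ae_eq_Ioc.symm)
    _ = volume (Set.Icc 0 φ ∩ Set.Ico 0 p) := by
        congr 1
        ext θ
        refine and_congr_left fun hθ => ?_
        rw [hA, Set.mem_ofPred_eq, (toIcoMod_eq_self hp).2 (by simpa using hθ)]
        exact ⟨fun h => ⟨hθ.1, h⟩, fun h => h.2⟩
    _ = volume (Set.Icc 0 φ ∩ Set.Icc 0 p) :=
        measure_congr (.inter (ae_eq_refl _) Ico_ae_eq_Icc)
    _ = ENNReal.ofReal φ := by
        rw [Set.inter_eq_left.2 (Set.Icc_subset_Icc_right hφp), Real.volume_Icc, sub_zero]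

theorem lintegral_Ioc_ofReal {R : ℝ} (hR : 0 ≤ R) :
    ∫⁻ t in Set.Ioc 0 R, ENNReal.ofReal t = ENNReal.ofReal (R ^ 2 / 2) := by
  rw [← ofReal_integral_eq_lintegral_ofReal, ← intervalIntegral.integral_of_le hR, integral_id]
  · simp
  · exact (continuous_id.integrableOn_Icc (a := 0) (b := R)).mono_set Set.Ioc_subset_Icc_self
  · filter_upwards [ae_restrict_mem measurableSet_Ioc] with t ht using ht.1.le

theorem polarCoord_symm_mem_sector_iff {A : Set ℝ} {R : ℝ} {p : ℝ × ℝ}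
    (hp : p ∈ polarCoord.target) :
    (Complex.polarCoord.symm p).arg ∈ A ∧ ‖Complex.polarCoord.symm p‖ ≤ R ↔
      p ∈ Set.Ioc 0 R ×ˢ (A ∩ Set.Ioo (-Real.pi) Real.pi) := by
  obtain ⟨hρ, hθ⟩ : 0 < p.1 ∧ p.2 ∈ Set.Ioo (-Real.pi) Real.pi := hp
  have harg : (Complex.polarCoord.symm p).arg = p.2 := by
    rw [Complex.polarCoord_symm_apply]
    push_cast
    exact Complex.arg_mul_cos_add_sin_mul_I hρ ⟨hθ.1, hθ.2.le⟩
  rw [harg, Complex.norm_polarCoord_symm, abs_of_pos hρ]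
  exact ⟨fun h => ⟨⟨hρ, h.2⟩, h.1, hθ⟩, fun h => ⟨h.2.1, h.1.2⟩⟩

theorem measurableSet_complex_sector {A : Set ℝ} (hA : MeasurableSet A) (R : ℝ) :
    MeasurableSet {z : ℂ | z.arg ∈ A ∧ ‖z‖ ≤ R} :=
  (Complex.measurable_arg hA).inter (measurableSet_le measurable_norm measurable_const)

theorem volume_complex_sector {A : Set ℝ} (hA : MeasurableSet A) {R : ℝ} (hR : 0 ≤ R) :
    volume {z : ℂ | z.arg ∈ A ∧ ‖z‖ ≤ R} =
      ENNReal.ofReal (R ^ 2 / 2) * volume (A ∩ Set.Ioo (-Real.pi) Real.pi) := by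
  set S := {z : ℂ | z.arg ∈ A ∧ ‖z‖ ≤ R}
  set T := Set.Ioc 0 R ×ˢ (A ∩ Set.Ioo (-Real.pi) Real.pi) with hT
  have hTm : MeasurableSet T := measurableSet_Ioc.prod (hA.inter measurableSet_Ioo)
  have hTtarget : T ⊆ polarCoord.target := fun p hp => ⟨hp.1.1, hp.2.2⟩
  have hindicator (p : ℝ × ℝ) (hp : p ∈ polarCoord.target) :
      ENNReal.ofReal p.1 • S.indicator (1 : ℂ → ℝ≥0∞) (Complex.polarCoord.symm p) =
        T.indicator (fun p => ENNReal.ofReal p.1) p := by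
    have hiff : Complex.polarCoord.symm p ∈ S ↔ p ∈ T := polarCoord_symm_mem_sector_iff hp
    by_cases hpT : p ∈ T
    · rw [Set.indicator_of_mem hpT, Set.indicator_of_mem (hiff.2 hpT)]
      simp
    · rw [Set.indicator_of_notMem hpT, Set.indicator_of_notMem (mt hiff.1 hpT), smul_zero]
  calc volume S
      = ∫⁻ p in polarCoord.target,
          ENNReal.ofReal p.1 • S.indicator (1 : ℂ → ℝ≥0∞) (Complex.polarCoord.symm p) := by
        rw [Complex.lintegral_comp_polarCoord_symm,
          lintegral_indicator_one (measurableSet_complex_sector hA R)]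
    _ = ∫⁻ p in T, ENNReal.ofReal p.1 := by
        rw [setLIntegral_congr_fun polarCoord.open_target.measurableSet hindicator,
          lintegral_indicator hTm, Measure.restrict_restrict hTm, Set.inter_eq_left.2 hTtarget]
    _ = ENNReal.ofReal (R ^ 2 / 2) * volume (A ∩ Set.Ioo (-Real.pi) Real.pi) := by
        rw [hT, Measure.volume_eq_prod, ← Measure.prod_restrict, lintegral_prod _ (by fun_prop)]
        simp only [lintegral_const, Measure.restrict_apply MeasurableSet.univ, Set.univ_inter]
        rw [lintegral_mul_const _ (by fun_prop), lintegral_Ioc_ofReal hR]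

theorem measurePreserving_complex_mk :
    MeasurePreserving fun v : Plane => (⟨v 0, v 1⟩ : ℂ) := by
  convert! Complex.volume_preserving_equiv_pi.symm.comp (PiLp.volume_preserving_ofLp (Fin 2))
    using 1
  ext v
  apply Complex.ext <;> simp

theorem measurable_planeAngle : Measurable planeAngle :=
  (measurable_toIcoMod Real.two_pi_pos 0).comp
    (Complex.measurable_arg.comp measurePreserving_complex_mk.measurable)

theorem volume_sector {φ R : ℝ} (hφ : φ ≤ 2 * Real.pi) (hR : 0 ≤ R) :
    volume {v : Plane | planeAngle v ≤ φ ∧ ‖v‖ ≤ R} = ENNReal.ofReal (φ / 2 * R ^ 2) := by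
  let A : Set ℝ := {θ | toIcoMod Real.two_pi_pos 0 θ ≤ φ}
  have hA : MeasurableSet A :=
    measurableSet_le (measurable_toIcoMod Real.two_pi_pos 0) measurable_const
  have hnorm (v : Plane) : ‖(⟨v 0, v 1⟩ : ℂ)‖ = ‖v‖ := by
    rw [EuclideanSpace.norm_eq, Complex.norm_eq_sqrt_sq_add_sq]
    simp
  have hpreimage : {v : Plane | planeAngle v ≤ φ ∧ ‖v‖ ≤ R} =
      (fun v : Plane => (⟨v 0, v 1⟩ : ℂ)) ⁻¹' {z | z.arg ∈ A ∧ ‖z‖ ≤ R} := by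
    ext v
    simp [planeAngle, A, hnorm]
  have hangle := volume_toIcoMod_le_inter_Ioo Real.two_pi_pos hφ (-Real.pi)
  rw [show -Real.pi + 2 * Real.pi = Real.pi by ring] at hangle
  rw [hpreimage, measurePreserving_complex_mk.measure_preimage
    (measurableSet_complex_sector hA R).nullMeasurableSet, volume_complex_sector hA hR, hangle,
    ← ENNReal.ofReal_mul (by positivity)]
  congr 1
  ring

end SectorArea

section TransformedProcess

variable {lam α φ : ℝ} {r : Plane} {ν : Measure ℝ}

/-- The mapping of the marked process (node position, channel gain) to the power axis. Nodes
that are not interferers are sent to `-1`, outside the range `[0, ∞)` of the transformed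
process. -/
noncomputable def transformedPoint (α φ : ℝ) (r : Plane) (p : Plane × ℝ) : ℝ :=
  if planeAngle (p.1 - r) ≤ φ then ‖p.1 - r‖ ^ α / p.2 else -1

theorem measurable_transformedPoint (α φ : ℝ) (r : Plane) :
    Measurable (transformedPoint α φ r) :=
  .ite (measurableSet_le (measurable_planeAngle.comp (by fun_prop)) measurable_const)
    (by fun_prop) measurable_const

theorem transformedPoint_mem_iff {B : Set ℝ} (hB : B ⊆ Set.Ici 0) {p : Plane × ℝ} :
    transformedPoint α φ r p ∈ B ↔ planeAngle (p.1 - r) ≤ φ ∧ ‖p.1 - r‖ ^ α / p.2 ∈ B := by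
  have hneg : (-1 : ℝ) ∉ B := fun h => absurd (hB h) (by norm_num)
  unfold transformedPoint
  split_ifs with hangle <;> simp [hangle, hneg]

theorem transformedPoint_of_mem_interferers {x : ℕ → Plane} {h : ℕ → ℝ} {i : ℕ}
    (hi : i ∈ interferers r φ x) :
    transformedPoint α φ r (x i, h i) = ‖x i - r‖ ^ α / h i :=
  if_pos hi

theorem transformedCount_eq_pointCount (α φ : ℝ) (r : Plane) (x : ℕ → Plane) (h : ℕ → ℝ) (z : ℝ) :
    transformedCount α φ r x h z =
      pointCount (fun i => transformedPoint α φ r (x i, h i)) (Set.Icc 0 z) := by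
  simp only [transformedCount, pointCount, transformedPoint_mem_iff Set.Icc_subset_Ici_self,
    interferers, Set.mem_ofPred_eq]

/-- The intensity measure of the transformed process when the nodes form a homogeneous Poisson
process of intensity `lam` and the channel gains have law `ν`. -/
noncomputable def transformedMeasure (lam α φ : ℝ) (r : Plane) (ν : Measure ℝ) : Measure ℝ :=
  ((ENNReal.ofReal lam • (volume : Measure Plane)).prod ν).map (transformedPoint α φ r)

theorem transformedMeasure_apply [SFinite ν] {B : Set ℝ} (hB : MeasurableSet B)
    (hBpos : B ⊆ Set.Ici 0) :
    transformedMeasure lam α φ r ν B = ∫⁻ t, ENNReal.ofReal lam *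
      volume {y : Plane | planeAngle (y - r) ≤ φ ∧ ‖y - r‖ ^ α / t ∈ B} ∂ν := by
  have hmeas := measurable_transformedPoint α φ r
  rw [transformedMeasure, Measure.map_apply hmeas hB, Measure.prod_apply_symm (hmeas hB)]
  refine lintegral_congr fun t => ?_
  rw [Measure.smul_apply, smul_eq_mul]
  congr 2
  ext y
  exact transformedPoint_mem_iff hBpos

theorem volume_setOf_norm_rpow_div_mem_Icc (hα : 0 < α) (hφ : φ ≤ 2 * Real.pi) (r : Plane)
    {z t : ℝ} (hz : 0 ≤ z) (ht : 0 < t) :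
    volume {y : Plane | planeAngle (y - r) ≤ φ ∧ ‖y - r‖ ^ α / t ∈ Set.Icc 0 z} =
      ENNReal.ofReal (φ / 2 * z ^ (2 / α) * t ^ (2 / α)) := by
  have hshift : {y : Plane | planeAngle (y - r) ≤ φ ∧ ‖y - r‖ ^ α / t ∈ Set.Icc 0 z} =
      (fun y => y - r) ⁻¹' {v | planeAngle v ≤ φ ∧ ‖v‖ ≤ (z * t) ^ (1 / α)} := by
    ext y
    refine and_congr_right fun _ => ?_
    rw [Set.mem_Icc, div_le_iff₀ ht, and_iff_right (by positivity), one_div,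
      Real.le_rpow_inv_iff_of_pos (norm_nonneg _) (by positivity) hα]
  rw [hshift, (measurePreserving_sub_right volume r).measure_preimage_emb
    (measurableEmbedding_subRight r), volume_sector hφ (by positivity),
    ← Real.rpow_mul_natCast (by positivity), Nat.cast_ofNat, one_div_mul_eq_div,
    Real.mul_rpow hz ht.le, mul_assoc]

theorem transformedMeasure_Icc [SFinite ν] (hlam : 0 ≤ lam) (hα : 0 < α) (hφ : 0 ≤ φ)
    (hφ' : φ ≤ 2 * Real.pi) (r : Plane) (hpos : ∀ᵐ t ∂ν, 0 < t)
    (hint : Integrable (fun t => t ^ (2 / α)) ν) {z : ℝ} (hz : 0 ≤ z) :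
    transformedMeasure lam α φ r ν (Set.Icc 0 z) =
      ENNReal.ofReal (φ * lam / 2 * (∫ t, t ^ (2 / α) ∂ν) * z ^ (2 / α)) := by
  have hslice : ∀ᵐ t ∂ν, ENNReal.ofReal lam *
      volume {y : Plane | planeAngle (y - r) ≤ φ ∧ ‖y - r‖ ^ α / t ∈ Set.Icc 0 z} =
        ENNReal.ofReal (φ * lam / 2 * z ^ (2 / α) * t ^ (2 / α)) := by
    filter_upwards [hpos] with t ht
    rw [volume_setOf_norm_rpow_div_mem_Icc hα hφ' r hz ht, ← ENNReal.ofReal_mul hlam]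
    ring_nf
  rw [transformedMeasure_apply measurableSet_Icc Set.Icc_subset_Ici_self,
    lintegral_congr_ae hslice, ← ofReal_integral_eq_lintegral_ofReal (hint.const_mul _),
    integral_const_mul]
  · ring_nf
  · filter_upwards [hpos] with t ht
    positivity

theorem transformedMeasure_singleton [SFinite ν] (hα : 0 < α) (hpos : ∀ᵐ t ∂ν, 0 < t)
    {z : ℝ} (hz : 0 ≤ z) : transformedMeasure lam α φ r ν {z} = 0 := by
  rw [transformedMeasure_apply (measurableSet_singleton z) (Set.singleton_subset_iff.2 hz)]
  refine lintegral_eq_zero_of_ae_eq_zero ?_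
  filter_upwards [hpos] with t ht
  have hsphere : {y : Plane | planeAngle (y - r) ≤ φ ∧ ‖y - r‖ ^ α / t ∈ ({z} : Set ℝ)} ⊆
      Metric.sphere r ((z * t) ^ α⁻¹) := by
    rintro y ⟨-, hy⟩
    rw [Set.mem_singleton_iff, div_eq_iff ht.ne'] at hy
    rw [mem_sphere_iff_norm, ← hy, Real.rpow_rpow_inv (norm_nonneg _) hα.ne']
  rw [measure_mono_null hsphere (Measure.addHaar_sphere _ _ _), mul_zero, Pi.zero_apply]

theorem tendsto_transformedMeasure_Icc [IsProbabilityMeasure ν] (hlam : 0 < lam) (hα : 0 < α)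
    (hφ : 0 < φ) (hφ' : φ ≤ 2 * Real.pi) (r : Plane) (hpos : ∀ᵐ t ∂ν, 0 < t)
    (hint : Integrable (fun t => t ^ (2 / α)) ν) :
    Tendsto (fun k : ℕ => transformedMeasure lam α φ r ν (Set.Icc 0 k)) atTop (𝓝 ⊤) := by
  have hmoment : 0 < ∫ t, t ^ (2 / α) ∂ν := by
    have hrpow : ∀ᵐ t ∂ν, 0 < t ^ (2 / α) := hpos.mono fun t ht => Real.rpow_pos_of_pos ht _
    refine (integral_nonneg_of_ae (hrpow.mono fun _ => le_of_lt)).lt_of_ne' fun hzero => ?_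
    rw [integral_eq_zero_iff_of_nonneg_ae (hrpow.mono fun _ => le_of_lt) hint] at hzero
    obtain ⟨t, ht, ht0⟩ := (hrpow.and hzero).exists
    exact ht.ne' ht0
  simp_rw [transformedMeasure_Icc hlam.le hα hφ.le hφ' r hpos hint (Nat.cast_nonneg _)]
  refine ENNReal.tendsto_ofReal_nhds_top.2 (Tendsto.const_mul_atTop (by positivity) ?_)
  exact (tendsto_rpow_atTop (by positivity)).comp tendsto_natCast_atTop_atTop

end TransformedProcess

section Ranking

theorem nonempty_orderIso_nat_of_finite_Iic {T : Type*} [LinearOrder T] [Infinite T]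
    (hfin : ∀ a : T, (Set.Iic a).Finite) : Nonempty (ℕ ≃o T) := by
  let _ : LocallyFiniteOrder T :=
    .ofFiniteIcc fun a b => (hfin b).subset Set.Icc_subset_Iic_self
  obtain ⟨a⟩ : Nonempty T := inferInstance
  obtain ⟨b, -, hb⟩ := Set.exists_min_image (Set.Iic a) id (hfin a) ⟨a, le_rfl⟩
  let _ : OrderBot T :=
    { bot := b
      bot_le := fun c => (le_total c a).elim (hb c) fun hac => (hb a le_rfl).trans hac }
  have : NoMaxOrder T := ⟨fun c => by
    by_contra! hc
    exact Set.infinite_univ ((hfin c).subset fun d _ => hc d)⟩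
  let _ : SuccOrder T := LinearLocallyFiniteOrder.succOrder T
  let _ : PredOrder T := LinearLocallyFiniteOrder.predOrder T
  exact ⟨orderIsoNatOfLinearSuccPredArch.symm⟩

variable {ι β : Type*} [LinearOrder β] {S : Set ι} {p : ι → β}

theorem exists_bijOn_strictAnti (hinf : S.Infinite) (hinj : Set.InjOn p S)
    (hfin : ∀ i ∈ S, {j | j ∈ S ∧ p i ≤ p j}.Finite) :
    ∃ s : ℕ → ι, Set.BijOn s Set.univ S ∧ StrictAnti fun n => p (s n) := by
  let _ : LinearOrder S := LinearOrder.lift' (fun i : S => OrderDual.toDual (p i))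
    fun i j hij => Subtype.ext (hinj i.2 j.2 hij)
  have : Infinite S := hinf.to_subtype
  have hIic (i : S) : (Set.Iic i).Finite :=
    Set.Finite.of_finite_image ((hfin i i.2).subset (by rintro _ ⟨j, hj, rfl⟩; exact ⟨j.2, hj⟩))
      Subtype.val_injective.injOn
  obtain ⟨e⟩ := nonempty_orderIso_nat_of_finite_Iic hIic
  refine ⟨fun n => e n, ⟨fun n _ => (e n).2, fun m _ n _ hmn => ?_, fun i hi => ?_⟩,
    fun m n hmn => e.strictMono hmn⟩
  · exact e.injective (Subtype.ext hmn)
  · exact ⟨e.symm ⟨i, hi⟩, trivial, by simp⟩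

theorem isGreatest_of_bijOn_strictAnti {s : ℕ → ι} (hs : Set.BijOn s Set.univ S)
    (hanti : StrictAnti fun n => p (s n)) (n : ℕ) :
    IsGreatest {t | ((n + 1 : ℕ) : ℕ∞) ≤ {i | i ∈ S ∧ t ≤ p i}.encard} (p (s n)) := by
  have hs_inj : Function.Injective s := Set.injOn_univ.1 hs.injOn
  constructor
  · calc ((n + 1 : ℕ) : ℕ∞) = (s '' Set.Iic n).encard := by
          rw [hs_inj.encard_image, ← Finset.coe_Iic, Set.encard_coe_eq_coe_finsetCard,
            Nat.card_Iic]
      _ ≤ {i | i ∈ S ∧ p (s n) ≤ p i}.encard := Set.encard_le_encard <| by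
          rintro _ ⟨m, hm, rfl⟩
          exact ⟨hs.mapsTo trivial, hanti.antitone hm⟩
  · intro t ht
    by_contra! hlt
    have hsub : {i | i ∈ S ∧ t ≤ p i} ⊆ s '' Set.Iio n := by
      rintro i ⟨hi, hti⟩
      obtain ⟨m, -, rfl⟩ := hs.surjOn hi
      exact ⟨m, hanti.lt_iff_gt.1 (hlt.trans_le hti), rfl⟩
    have hcard := (Set.mem_ofPred_eq ▸ ht).trans (Set.encard_le_encard hsub)
    rw [hs_inj.encard_image, ← Finset.coe_Iio, Set.encard_coe_eq_coe_finsetCard, Nat.card_Iio,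
      Nat.cast_le] at hcard
    omega

end Ranking

section DominantPower

variable {α φ : ℝ} {r : Plane} {x : ℕ → Plane} {h : ℕ → ℝ}

/-- A pattern of nodes and channel gains whose transformed process is a simple, locally finite,
infinite set of points in `(0, ∞)`: the almost sure situation, in which the interference powers can
be ranked. -/
structure IsRankable (α φ : ℝ) (r : Plane) (x : ℕ → Plane) (h : ℕ → ℝ) : Prop where
  infinite : (interferers r φ x).Infinite
  pos : ∀ i ∈ interferers r φ x, 0 < ‖x i - r‖ ^ α / h i
  injOn : Set.InjOn (fun i => ‖x i - r‖ ^ α / h i) (interferers r φ x)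
  finite : ∀ z, {i | i ∈ interferers r φ x ∧ ‖x i - r‖ ^ α / h i ≤ z}.Finite

theorem power_eq_inv (α : ℝ) (r y : Plane) (t : ℝ) : power α r y t = (‖y - r‖ ^ α / t)⁻¹ := by
  rw [power, norm_sub_rev, Real.rpow_neg (norm_nonneg _), inv_div, div_eq_mul_inv]

theorem IsRankable.exists_enumeration (hrank : IsRankable α φ r x h) :
    ∃ s : ℕ → ℕ, Set.BijOn s Set.univ (interferers r φ x) ∧
      (StrictAnti fun n => power α r (x (s n)) (h (s n))) ∧
      ∀ n, nthDominant α φ r x h (n + 1) = power α r (x (s n)) (h (s n)) := by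
  have hinj : Set.InjOn (fun i => power α r (x i) (h i)) (interferers r φ x) := fun i hi j hj hij =>
    hrank.injOn hi hj (inv_injective (by simpa only [power_eq_inv] using hij))
  have hfin (i : ℕ) (hi : i ∈ interferers r φ x) :
      {j | j ∈ interferers r φ x ∧ power α r (x i) (h i) ≤ power α r (x j) (h j)}.Finite := by
    refine (hrank.finite (‖x i - r‖ ^ α / h i)).subset fun j hj => ⟨hj.1, ?_⟩
    have hij := hj.2
    rwa [power_eq_inv, power_eq_inv, inv_le_inv₀ (hrank.pos i hi) (hrank.pos j hj.1)] at hij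
  obtain ⟨s, hs, hanti⟩ := exists_bijOn_strictAnti hrank.infinite hinj hfin
  exact ⟨s, hs, hanti, fun n => (isGreatest_of_bijOn_strictAnti hs hanti n).csSup_eq⟩

theorem IsRankable.isDescendingArrangement (hrank : IsRankable α φ r x h) :
    IsDescendingArrangement α φ r x h (nthDominant α φ r x h) := by
  obtain ⟨s, hs, hanti, hdom⟩ := hrank.exists_enumeration
  exact ⟨by simpa only [hdom] using hanti, s, hs, hdom⟩

theorem IsRankable.exists_nthDominant_eq_inv (hrank : IsRankable α φ r x h) {n : ℕ} (hn : 1 ≤ n) :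
    ∃ i ∈ interferers r φ x, nthDominant α φ r x h n = (‖x i - r‖ ^ α / h i)⁻¹ := by
  obtain ⟨s, hs, -, hdom⟩ := hrank.exists_enumeration
  obtain ⟨n, rfl⟩ := Nat.exists_eq_add_of_le' hn
  exact ⟨s n, hs.mapsTo trivial, (hdom n).trans (power_eq_inv ..)⟩

theorem IsRankable.nthDominant_pos (hrank : IsRankable α φ r x h) {n : ℕ} (hn : 1 ≤ n) :
    0 < nthDominant α φ r x h n := by
  obtain ⟨i, hi, heq⟩ := hrank.exists_nthDominant_eq_inv hn
  exact heq ▸ inv_pos.2 (hrank.pos i hi)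

theorem IsRankable.transformedCount_lt_iff (hrank : IsRankable α φ r x h) {n : ℕ} (hn : 1 ≤ n)
    {z : ℝ} (hz : 0 < z) : transformedCount α φ r x h z⁻¹ < n ↔ nthDominant α φ r x h n < z := by
  obtain ⟨s, hs, hanti, hdom⟩ := hrank.exists_enumeration
  obtain ⟨m, rfl⟩ := Nat.exists_eq_add_of_le' hn
  have hgreatest := isGreatest_of_bijOn_strictAnti (p := fun i => power α r (x i) (h i)) hs hanti m
  have hcount : transformedCount α φ r x h z⁻¹ =
      {i | i ∈ interferers r φ x ∧ z ≤ power α r (x i) (h i)}.encard := by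
    rw [transformedCount]
    congr 1
    ext i
    refine and_congr_right fun hi => ?_
    rw [power_eq_inv, Set.mem_Icc, and_iff_right (hrank.pos i hi).le,
      le_inv_comm₀ hz (hrank.pos i hi)]
  rw [← not_le, ← not_le, not_iff_not, hcount, hdom]
  exact ⟨fun hle => hgreatest.2 hle, fun hle => hgreatest.1.trans <|
    Set.encard_le_encard fun i hi => ⟨hi.1, hle.trans hi.2⟩⟩

end DominantPower

section PoissonInterference

variable {Ω : Type*} [MeasurableSpace Ω] {P : Measure Ω} {α φ : ℝ} {r : Plane}
  {x : ℕ → Ω → Plane} {h : ℕ → Ω → ℝ} {ρ : Measure ℝ}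

/-- The channel gains are positive and the transformed process has Poisson counts, with a diffuse,
locally finite intensity measure `ρ` of infinite mass on the power axis `[0, ∞)`. -/
structure IsPoissonInterference (P : Measure Ω) (α φ : ℝ) (r : Plane) (x : ℕ → Ω → Plane)
    (h : ℕ → Ω → ℝ) (ρ : Measure ℝ) : Prop where
  counts : HasPoissonCounts P ρ fun i ω => transformedPoint α φ r (x i ω, h i ω)
  gain_pos : ∀ᵐ ω ∂P, ∀ i, 0 < h i ω
  finite : ∀ z, ρ (Set.Icc 0 z) ≠ ⊤
  diffuse : ∀ z, 0 ≤ z → ρ {z} = 0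
  tendsto : Tendsto (fun k : ℕ => ρ (Set.Icc 0 k)) atTop (𝓝 ⊤)

theorem IsPoissonInterference.ae_transformedPoint_pos (hρ : IsPoissonInterference P α φ r x h ρ) :
    ∀ᵐ ω ∂P, ∀ i ∈ interferers r φ (fun i => x i ω),
      0 < transformedPoint α φ r (x i ω, h i ω) := by
  have hzero := hρ.counts.ae_forall_notMem (measurableSet_singleton 0) (hρ.diffuse 0 le_rfl)
  filter_upwards [hρ.gain_pos, hzero] with ω hgain hne i hi
  refine lt_of_le_of_ne' ?_ (hne i)
  rw [transformedPoint_of_mem_interferers (x := fun i => x i ω) (h := fun i => h i ω) hi]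
  exact div_nonneg (by positivity) (hgain i).le

theorem IsPoissonInterference.ae_isRankable (hρ : IsPoissonInterference P α φ r x h ρ) :
    ∀ᵐ ω ∂P, IsRankable α φ r (fun i => x i ω) fun i => h i ω := by
  have hinf := hρ.counts.ae_infinite (fun k : ℕ => measurableSet_Icc (a := (0 : ℝ)) (b := k))
    (fun k => hρ.finite k) hρ.tendsto
  have hinj := ae_all_iff.2 fun k : ℕ => hρ.counts.ae_injOn measurableSet_Icc (hρ.finite k)
    fun z hz => hρ.diffuse z hz.1
  have hfin := ae_all_iff.2 fun k : ℕ => hρ.counts.ae_finite measurableSet_Icc (hρ.finite k)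
  filter_upwards [hρ.ae_transformedPoint_pos, hinf, hinj, hfin] with ω hpos hinf hinj hfin
  have heq (i : ℕ) (hi : i ∈ interferers r φ fun i => x i ω) :=
    transformedPoint_of_mem_interferers (α := α) (h := fun i => h i ω) hi
  refine ⟨hinf.mono fun i hi => ?_, fun i hi => heq i hi ▸ hpos i hi, fun i hi j hj hij => ?_,
    fun z => ?_⟩
  · obtain ⟨k, hk⟩ := Set.mem_iUnion.1 hi
    exact ((transformedPoint_mem_iff Set.Icc_subset_Ici_self).1 hk).1
  · obtain ⟨k, hk⟩ := exists_nat_ge (transformedPoint α φ r (x i ω, h i ω))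
    have hij' : transformedPoint α φ r (x i ω, h i ω) = transformedPoint α φ r (x j ω, h j ω) :=
      ((heq i hi).trans hij).trans (heq j hj).symm
    exact hinj k ⟨(hpos i hi).le, hk⟩ ⟨(hpos j hj).le, hij' ▸ hk⟩ hij'
  · obtain ⟨k, hk⟩ := exists_nat_ge z
    refine (hfin k).subset fun i ⟨hi, hiz⟩ => ⟨(hpos i hi).le, ?_⟩
    exact (heq i hi).trans_le (hiz.trans hk)

theorem IsPoissonInterference.hasLaw_transformedCount (hρ : IsPoissonInterference P α φ r x h ρ)
    (z : ℝ) :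
    HasLaw (fun ω => transformedCount α φ r (fun i => x i ω) (fun i => h i ω) z)
      (poissonENat (ρ (Set.Icc 0 z)).toNNReal) P := by
  simp_rw [transformedCount_eq_pointCount]
  exact hρ.counts.count_law _ measurableSet_Icc (hρ.finite z)

theorem IsPoissonInterference.transformedIntensity_eq (hρ : IsPoissonInterference P α φ r x h ρ)
    (z : ℝ) : transformedIntensity P α φ r x h z = ρ (Set.Icc 0 z) := by
  simp_rw [transformedIntensity, transformedCount_eq_pointCount]
  exact hρ.counts.lintegral_pointCount measurableSet_Icc (hρ.finite z)

theorem IsPoissonInterference.measure_transformedCount_eq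
    (hρ : IsPoissonInterference P α φ r x h ρ) (z : ℝ) (k : ℕ) :
    P {ω | transformedCount α φ r (fun i => x i ω) (fun i => h i ω) z = k} =
      poissonMeasure (transformedIntensity P α φ r x h z).toNNReal {k} := by
  have hlaw := (hρ.hasLaw_transformedCount z).measure_eq (p := fun m => m = k)
    (measurableSet_singleton _)
  rw [hlaw, Set.ofPred_eq_eq_singleton, poissonENat_natCast_singleton, hρ.transformedIntensity_eq,
    poissonMeasure_singleton]

theorem IsPoissonInterference.ae_transformedCount_lt_iff
    (hρ : IsPoissonInterference P α φ r x h ρ) {n : ℕ} (hn : 1 ≤ n) {z : ℝ} (hz : 0 < z) :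
    ∀ᵐ ω ∂P, transformedCount α φ r (fun i => x i ω) (fun i => h i ω) z⁻¹ < n ↔
      nthDominant α φ r (fun i => x i ω) (fun i => h i ω) n ≤ z := by
  have hnone := hρ.counts.ae_forall_notMem (measurableSet_singleton z⁻¹)
    (hρ.diffuse z⁻¹ (inv_pos.2 hz).le)
  filter_upwards [hρ.ae_isRankable, hnone] with ω hrank hnone
  rw [hrank.transformedCount_lt_iff hn hz, le_iff_lt_or_eq, or_iff_left]
  intro hdom
  obtain ⟨i, hi, heq⟩ := hrank.exists_nthDominant_eq_inv hn
  refine hnone i ?_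
  rw [Set.mem_singleton_iff, ← hdom, heq, inv_inv]
  exact transformedPoint_of_mem_interferers (h := fun i => h i ω) hi

theorem IsPoissonInterference.aemeasurable_nthDominant
    (hρ : IsPoissonInterference P α φ r x h ρ) {n : ℕ} (hn : 1 ≤ n) :
    AEMeasurable (fun ω => nthDominant α φ r (fun i => x i ω) (fun i => h i ω) n) P := by
  refine NullMeasurable.aemeasurable <|
    measurable_of_Iio (δ := NullMeasurableSpace Ω P) fun z => ?_
  rcases le_or_gt z 0 with hz | hz
  · refine NullMeasurableSet.of_null (μ := P) (measure_eq_zero_iff_ae_notMem.2 ?_)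
    filter_upwards [hρ.ae_isRankable] with ω hrank hlt
    exact (hrank.nthDominant_pos hn).not_gt (hlt.trans_le hz)
  · refine ((hρ.hasLaw_transformedCount z⁻¹).aemeasurable.nullMeasurableSet_preimage
      (.of_discrete (s := Set.Iio (n : ℕ∞)))).congr ?_
    filter_upwards [hρ.ae_isRankable] with ω hrank
    exact propext (hrank.transformedCount_lt_iff hn hz)

theorem IsPoissonInterference.cdf_nthDominant_of_pos [IsProbabilityMeasure P]
    (hρ : IsPoissonInterference P α φ r x h ρ) {n : ℕ} (hn : 1 ≤ n) {z : ℝ} (hz : 0 < z) :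
    cdf (P.map fun ω => nthDominant α φ r (fun i => x i ω) (fun i => h i ω) n) z =
      upperGamma n (transformedIntensity P α φ r x h z⁻¹).toReal / Real.Gamma n := by
  have hmeas := hρ.aemeasurable_nthDominant hn
  have := Measure.isProbabilityMeasure_map hmeas
  have hcdf : P {ω | nthDominant α φ r (fun i => x i ω) (fun i => h i ω) n ≤ z} =
      poissonENat (ρ (Set.Icc 0 z⁻¹)).toNNReal (Set.Iio n) :=
    (measure_congr (hρ.ae_transformedCount_lt_iff hn hz).set_eq).symm.trans <|
      (hρ.hasLaw_transformedCount z⁻¹).measure_eq (p := fun k => k < n) .of_discrete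
  calc cdf (P.map fun ω => nthDominant α φ r (fun i => x i ω) (fun i => h i ω) n) z
      = P.real {ω | nthDominant α φ r (fun i => x i ω) (fun i => h i ω) n ≤ z} := by
        rw [cdf_eq_real, map_measureReal_apply_of_aemeasurable hmeas measurableSet_Iic]
        rfl
    _ = (poissonENat (ρ (Set.Icc 0 z⁻¹)).toNNReal).real (Set.Iio n) :=
        congrArg ENNReal.toReal hcdf
    _ = upperGamma n (transformedIntensity P α φ r x h z⁻¹).toReal / Real.Gamma n := by
        rw [poissonENat_real_Iio _ hn, hρ.transformedIntensity_eq, ENNReal.coe_toNNReal_eq_toReal]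

theorem IsPoissonInterference.cdf_nthDominant_of_nonpos [IsProbabilityMeasure P]
    (hρ : IsPoissonInterference P α φ r x h ρ) {n : ℕ} (hn : 1 ≤ n) {z : ℝ} (hz : z ≤ 0) :
    cdf (P.map fun ω => nthDominant α φ r (fun i => x i ω) (fun i => h i ω) n) z = 0 := by
  have hmeas := hρ.aemeasurable_nthDominant hn
  have := Measure.isProbabilityMeasure_map hmeas
  rw [cdf_eq_real, map_measureReal_apply_of_aemeasurable hmeas measurableSet_Iic,
    measureReal_eq_zero_iff]
  refine measure_eq_zero_iff_ae_notMem.2 ?_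
  filter_upwards [hρ.ae_isRankable] with ω hrank hle
  exact (hrank.nthDominant_pos hn).not_ge (hle.trans hz)

end PoissonInterference

section HomogeneousNodes

variable {Ω : Type*} [MeasurableSpace Ω] {P : Measure Ω} [IsProbabilityMeasure P] {lam α φ : ℝ}
  {x : ℕ → Ω → Plane} {h : ℕ → Ω → ℝ} {ν : Measure ℝ}

theorem IsHomogeneousPPP.isPoissonInterference [IsProbabilityMeasure ν] (hlam : 0 < lam)
    (hα : 0 < α) (hφ : 0 < φ) (hφ' : φ ≤ 2 * Real.pi) (r : Plane) (hx : IsHomogeneousPPP P lam x)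
    (hlaw : ∀ i, HasLaw (h i) ν P) (hindep : iIndepFun h P) (hpos : ∀ᵐ t ∂ν, 0 < t)
    (hmoment : Integrable (fun t => t ^ (2 / α)) ν)
    (hmark : IndepFun (fun ω i => x i ω) (fun ω i => h i ω) P) :
    IsPoissonInterference P α φ r x h (transformedMeasure lam α φ r ν) where
  counts :=
    ((hx.isPoissonProcess hlam).hasPoissonPGFL.prodMk hlaw hindep hmark).hasPoissonCounts.map
      (measurable_transformedPoint α φ r)
  gain_pos := ae_all_iff.2 fun i =>
    ae_of_ae_map (hlaw i).aemeasurable ((hlaw i).map_eq.symm ▸ hpos)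
  finite z := by
    refine measure_ne_top_of_subset (Set.Icc_subset_Icc_right (le_max_left z 0)) ?_
    rw [transformedMeasure_Icc hlam.le hα hφ.le hφ' r hpos hmoment (le_max_right z 0)]
    exact ENNReal.ofReal_ne_top
  diffuse _ := transformedMeasure_singleton hα hpos
  tendsto := tendsto_transformedMeasure_Icc hlam hα hφ hφ' r hpos hmoment

end HomogeneousNodes

theorem mainTheorem4_general {Ω : Type*} [MeasurableSpace Ω] (P : Measure Ω)
    [IsProbabilityMeasure P] (lam α φ : ℝ) (hlam : 0 < lam) (hα : 0 < α) (hφ : 0 < φ)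
    (hφ' : φ ≤ 2 * Real.pi) (r : Plane) (x : ℕ → Ω → Plane) (hx : IsHomogeneousPPP P lam x)
    (h : ℕ → Ω → ℝ) (hindep : iIndepFun h P) (hident : ∀ i, IdentDistrib (h i) (h 0) P P)
    (hpos : ∀ᵐ ω ∂P, 0 < h 0 ω) (hmoment : Integrable (fun ω => h 0 ω ^ (2 / α)) P)
    (hmark : IndepFun (fun ω i => x i ω) (fun ω i => h i ω) P) :
    (∀ᵐ ω ∂P, IsDescendingArrangement α φ r (fun i => x i ω) (fun i => h i ω)
      (nthDominant α φ r (fun i => x i ω) (fun i => h i ω))) ∧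
    (∀ z : ℝ, 0 ≤ z →
      transformedIntensity P α φ r x h z =
        ENNReal.ofReal (φ * lam / 2 * (∫ ω, h 0 ω ^ (2 / α) ∂P) * z ^ (2 / α)) ∧
      ∀ k : ℕ, P {ω | transformedCount α φ r (fun i => x i ω) (fun i => h i ω) z = k} =
        poissonMeasure (transformedIntensity P α φ r x h z).toNNReal {k}) ∧
    (∀ n : ℕ, 1 ≤ n →
      AEMeasurable (fun ω => nthDominant α φ r (fun i => x i ω) (fun i => h i ω) n) P ∧
      (∀ z : ℝ, 0 < z →
        cdf (P.map fun ω => nthDominant α φ r (fun i => x i ω) (fun i => h i ω) n) z =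
          upperGamma n (transformedIntensity P α φ r x h z⁻¹).toReal / Real.Gamma n) ∧
      (∀ z : ℝ, z ≤ 0 →
        cdf (P.map fun ω => nthDominant α φ r (fun i => x i ω) (fun i => h i ω) n) z = 0)) := by
  have hgain : AEMeasurable (h 0) P := (hident 0).aemeasurable_fst
  have hprob := Measure.isProbabilityMeasure_map hgain
  have hpow : AEStronglyMeasurable (fun t : ℝ => t ^ (2 / α)) (P.map (h 0)) := by fun_prop
  have hpos' : ∀ᵐ t ∂P.map (h 0), 0 < t := (ae_map_iff hgain measurableSet_Ioi).2 hpos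
  have hmoment' := (integrable_map_measure hpow hgain).2 hmoment
  have hρ := hx.isPoissonInterference hlam hα hφ hφ' r
    (fun i => ⟨(hident i).aemeasurable_fst, (hident i).map_eq⟩) hindep hpos' hmoment' hmark
  refine ⟨hρ.ae_isRankable.mono fun ω hrank => hrank.isDescendingArrangement,
    fun z hz => ⟨?_, hρ.measure_transformedCount_eq z⟩,
    fun n hn => ⟨hρ.aemeasurable_nthDominant hn, fun z => hρ.cdf_nthDominant_of_pos hn,
      fun z => hρ.cdf_nthDominant_of_nonpos hn⟩⟩
  rw [hρ.transformedIntensity_eq, transformedMeasure_Icc hlam.le hα hφ.le hφ' r hpos' hmoment' hz,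
    integral_map hgain hpow]

end Interference

theorem mainTheorem4 {Ω : Type*} [MeasurableSpace Ω] (P : Measure Ω) [IsProbabilityMeasure P]
    (lam α φ : ℝ) (hlam : 0 < lam) (hα : 2 < α) (hφ : 0 < φ) (hφ' : φ ≤ 2 * Real.pi)
    (r : Interference.Plane)
    (x : ℕ → Ω → Interference.Plane) (hx : Interference.IsHomogeneousPPP P lam x)
    (h : ℕ → Ω → ℝ) (hmeas : ∀ i, Measurable (h i)) (hindep : iIndepFun h P)
    (hident : ∀ i, IdentDistrib (h i) (h 0) P P) (hpos : ∀ i, ∀ᵐ ω ∂P, 0 < h i ω)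
    (hmoment : Integrable (fun ω => h 0 ω ^ (2 / α)) P)
    (hmark : IndepFun (fun ω i => x i ω) (fun ω i => h i ω) P) :
    (∀ᵐ ω ∂P, Interference.IsDescendingArrangement α φ r (fun i => x i ω) (fun i => h i ω)
      (Interference.nthDominant α φ r (fun i => x i ω) (fun i => h i ω))) ∧
    (∀ z : ℝ, 0 ≤ z →
      Interference.transformedIntensity P α φ r x h z =
        ENNReal.ofReal (φ * lam / 2 * (∫ ω, h 0 ω ^ (2 / α) ∂P) * z ^ (2 / α)) ∧
      ∀ k : ℕ,
        P {ω | Interference.transformedCount α φ r (fun i => x i ω) (fun i => h i ω) z = k} =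
          poissonMeasure (Interference.transformedIntensity P α φ r x h z).toNNReal {k}) ∧
    (∀ n : ℕ, 1 ≤ n →
      AEMeasurable
        (fun ω => Interference.nthDominant α φ r (fun i => x i ω) (fun i => h i ω) n) P ∧
      (∀ z : ℝ, 0 < z →
        cdf (P.map fun ω =>
            Interference.nthDominant α φ r (fun i => x i ω) (fun i => h i ω) n) z =
          Interference.upperGamma n (Interference.transformedIntensity P α φ r x h z⁻¹).toReal /
            Real.Gamma n) ∧
      (∀ z : ℝ, z ≤ 0 →
        cdf (P.map fun ω =>
            Interference.nthDominant α φ r (fun i => x i ω) (fun i => h i ω) n) z = 0)) :=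
  Interference.mainTheorem4_general P lam α φ hlam (two_pos.trans hα) hφ hφ' r x hx h hindep hident
    (hpos 0) hmoment hmark
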